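/- Let $k$ be a perfect field of characteristic $p>0$. A lifting of a $k$-scheme $V$ is a flat $W_2(k)$-scheme $\widetilde V$ together with an identification $V\simeq \widetilde V\otimes_{W_2(k)}k$; liftings of closed subschemes are understood to be closed subschemes of the lifting of the ambient scheme (embedded deformations). A lifting of the absolute Frobenius $F_V$ to $\widetilde V$ is a morphism $\widetilde F_V\colon\widetilde V\to\widetilde V$ restricting to $F_V$ on $V$. For a closed subscheme $\widetilde W\subseteq\widetilde V$ with ideal sheaf $\mathcal I_{\widetilde W}$, we say that $\widetilde F_V$ is compatible with $\widetilde W$ if $\widetilde F_V^{\#}(\mathcal I_{\widetilde W})\subseteq \mathcal I_{\widetilde W}^{\,p}$, i.e. if the image of $\widetilde F_V^*\mathcal I_{\widetilde W}\to\mathcal O_{\widetilde V}$ is contained in $\mathcal I_{\widetilde W}^{\,p}$. Let $X$ be a smooth scheme over $k$, let $Z\subseteq X$ be a closed subscheme which is smooth over $k$ and of codimension $>1$ in $X$ (at every point of $Z$), let $\pi\colon Y\to X$ be the blow-up of $X$ along $Z$, and let $E=\pi^{-1}(Z)$ be the exceptional divisor. Let $\widetilde Y$ be a lifting of $Y$,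 and let $\widetilde E\subseteq \widetilde Y$, $\widetilde X$ and $\widetilde Z\subseteq\widetilde X$ be the induced liftings of $E\subseteq Y$, $X$ and $Z\subseteq X$, i.e. liftings fitting into a commutative square $$\begin{array}{ccc}\widetilde E&\longrightarrow&\widetilde Y\\ \downarrow&&\downarrow{\scriptstyle\widetilde\pi}\\ \widetilde Z&\longrightarrow&\widetilde X\end{array}$$ of $W_2(k)$-schemes in which $\widetilde\pi$ lifts $\pi$. Then $\widetilde\pi\colon\widetilde Y\to\widetilde X$ is the blow-up of $\widetilde X$ along $\widetilde Z$. Moreover, a lifting $\widetilde F_X$ of $F_X$ to $\widetilde X$ extends to $\widetilde Y$, i.e. there is a lifting $\widetilde F_Y$ of $F_Y$ to $\widetilde Y$ with $\widetilde\pi\circ\widetilde F_Y=\widetilde F_X\circ\widetilde\pi$, if and only if $\widetilde F_X$ is compatible with $\widetilde Z$. Every such $\widetilde F_Y$ is compatible with $\widetilde E$. -/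

import Mathlib

open CategoryTheory CategoryTheory.Limits AlgebraicGeometry TopologicalSpace Opposite

universe u

namespace FrobLift

noncomputable section

/-! ### The ring `W₂(k)` and its residue map -/

/-- The ring `W₂(R)` of `p`-typical Witt vectors of length two. -/
abbrev W₂ (p : ℕ) (R : Type u) : Type u := TruncatedWittVector p 2 R

/-- The reduction map `W₂(R) → R`, `(a₀, a₁) ↦ a₀`. -/
def residue (p : ℕ) [Fact p.Prime] (R : Type u) [CommRing R] : W₂ p R →+* R where
  toFun x := x.coeff 0
  map_one' := by
    have h := WittVector.coeff_truncate (p := p) (1 : WittVector p R) (0 : Fin 2)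
    rw [map_one] at h
    simpa using h
  map_zero' := by
    simp
  map_mul' x y := by
    obtain ⟨x, rfl⟩ := WittVector.truncate_surjective p 2 R x
    obtain ⟨y, rfl⟩ := WittVector.truncate_surjective p 2 R y
    rw [← map_mul]
    simp only [WittVector.coeff_truncate]
    exact WittVector.mul_coeff_zero x y
  map_add' x y := by
    obtain ⟨x, rfl⟩ := WittVector.truncate_surjective p 2 R x
    obtain ⟨y, rfl⟩ := WittVector.truncate_surjective p 2 R y
    rw [← map_add]
    simp only [WittVector.coeff_truncate]
    exact WittVector.add_coeff_zero x y

/-- The closed immersion `Spec k → Spec W₂(k)`. -/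
def specResidue (p : ℕ) [Fact p.Prime] (k : Type u) [CommRing k] :
    Spec (CommRingCat.of k) ⟶ Spec (CommRingCat.of (W₂ p k)) :=
  Spec.map (CommRingCat.ofHom (residue p k))

/-! ### Absolute Frobenius -/

/-- The `p`-th power map of a commutative ring in which `p = 0`. -/
def powRingHom (p : ℕ) [hp : Fact p.Prime] (R : Type u) [CommRing R] (h : (p : R) = 0) :
    R →+* R where
  toFun x := x ^ p
  map_one' := one_pow p
  map_zero' := zero_pow hp.out.ne_zero
  map_mul' x y := mul_pow x y p
  map_add' x y := by
    obtain ⟨r, hr⟩ := exists_add_pow_prime_eq hp.out x y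
    rw [hr, h]
    simp

/-- On a scheme over a ring of characteristic `p`, the number `p` vanishes in every ring of
sections. -/
theorem natCast_section_eq_zero {p : ℕ} {k : Type u} [CommRing k] [CharP k p]
    {X : Scheme.{u}} (s : X ⟶ Spec (CommRingCat.of k)) (U : X.Opens) :
    ((p : ℕ) : Γ(X, U)) = 0 := by
  let φ : k →+* Γ(X, U) :=
    (X.presheaf.map (homOfLE le_top : U ⟶ ⊤).op).hom.comp
      ((s.appTop).hom.comp (Scheme.ΓSpecIso (CommRingCat.of k)).inv.hom)
  rw [← map_natCast φ p, CharP.cast_eq_zero, map_zero]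

/-- The absolute Frobenius of a scheme over a ring of characteristic `p`: the identity on the
underlying space and `f ↦ f ^ p` on sections. -/
def absFrobenius (p : ℕ) [hp : Fact p.Prime] {k : Type u} [CommRing k] [CharP k p]
    {X : Scheme.{u}} (s : X ⟶ Spec (CommRingCat.of k)) : X ⟶ X :=
  Scheme.Hom.mk
    { base := 𝟙 _
      c :=
        { app := fun U => CommRingCat.ofHom
            (powRingHom p Γ(X, U.unop) (natCast_section_eq_zero s U.unop))
          naturality := by
            intro U V i
            ext x
            exact (map_pow (X.presheaf.map i).hom x p).symm }
      prop := by
        intro x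
        constructor
        intro a ha
        obtain ⟨U, hxU, f, rfl⟩ := X.presheaf.exists_germ_eq a
        have ha' : IsUnit ((X.presheaf.germ U x hxU).hom (f ^ p)) := by
          rw [PresheafedSpace.stalkMap_germ_apply] at ha
          exact ha
        rw [map_pow] at ha'
        exact (isUnit_pow_iff hp.out.ne_zero).mp ha' }

@[simp]
theorem absFrobenius_apply (p : ℕ) [hp : Fact p.Prime] {k : Type u} [CommRing k] [CharP k p]
    {X : Scheme.{u}} (s : X ⟶ Spec (CommRingCat.of k)) (x : X) : absFrobenius p s x = x :=
  rfl

theorem absFrobenius_app (p : ℕ) [hp : Fact p.Prime] {k : Type u} [CommRing k] [CharP k p]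
    {X : Scheme.{u}} (s : X ⟶ Spec (CommRingCat.of k)) (U : X.Opens) (f : Γ(X, U)) :
    ((absFrobenius p s).app U).hom f = f ^ p :=
  rfl

/-! ### Ideal sheaves and blow-ups -/

/-- A quasi-coherent ideal sheaf is invertible (its closed subscheme is an effective Cartier
divisor) if, locally, it is generated by one element which is not a zero divisor. -/
def IsInvertibleIdeal {X : Scheme.{u}} (I : X.IdealSheafData) : Prop :=
  ∀ x : X, ∃ U : X.affineOpens, x ∈ U.1 ∧
    ∃ f : Γ(X, U.1), f ∈ nonZeroDivisors Γ(X, U.1) ∧ I.ideal U = Ideal.span {f}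

/-- `π : Y ⟶ X` is the blow-up of `X` along the closed subscheme with ideal sheaf `I`: the inverse
image ideal sheaf `I · 𝒪_Y` is invertible, and `π` is universal (terminal) among the morphisms to
`X` with this property. -/
structure IsBlowup {X Y : Scheme.{u}} (π : Y ⟶ X) (I : X.IdealSheafData) : Prop where
  isInvertibleIdeal : IsInvertibleIdeal (I.comap π)
  existsUnique_lift : ∀ (T : Scheme.{u}) (g : T ⟶ X), IsInvertibleIdeal (I.comap g) →
    ∃! h : T ⟶ Y, h ≫ π = g

/-! ### Liftings modulo `p²` -/

/-- `i : X ⟶ X₂` makes the `W₂(k)`-scheme `s₂ : X₂ ⟶ Spec W₂(k)` a lifting of the `k`-scheme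
`s : X ⟶ Spec k`: it is flat over `W₂(k)`, and `i` identifies `X` with `X₂ ⊗ k`. -/
structure IsLifting (p : ℕ) [Fact p.Prime] {k : Type u} [CommRing k] {X X₂ : Scheme.{u}}
    (s : X ⟶ Spec (CommRingCat.of k)) (s₂ : X₂ ⟶ Spec (CommRingCat.of (W₂ p k)))
    (i : X ⟶ X₂) : Prop where
  flat : Flat s₂
  isPullback : IsPullback i s s₂ (specResidue p k)

/-- An endomorphism `F` of a lifting `i : X ⟶ X₂` lifts the absolute Frobenius of `X`. -/
def LiftsFrobenius (p : ℕ) [Fact p.Prime] {k : Type u} [CommRing k] [CharP k p]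
    {X X₂ : Scheme.{u}} (s : X ⟶ Spec (CommRingCat.of k)) (i : X ⟶ X₂) (F : X₂ ⟶ X₂) : Prop :=
  i ≫ F = absFrobenius p s ≫ i

/-- The image of `F^* I → 𝒪` is contained in `I ^ p`. -/
def IsFrobeniusCompatible (p : ℕ) {X₂ : Scheme.{u}} (F : X₂ ⟶ X₂) (I : X₂.IdealSheafData) :
    Prop :=
  I.comap F ≤ I ^ p

end

end FrobLift

/-! Everything is reduced to algebra on the charts of the blow-up. For `x` in the ideal `I` of the
center over an affine open `Spec A`, the locus of `Y` where `x` generates `I·𝒪_Y` is affine with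
ring `A[I/x]`. This ring is pinned down by elementary conditions: `x` is a non-zero-divisor dividing
the image of `I`, every element is `b / x^n` with `b ∈ I^n`, and the kernel of `A → A[I/x]` is
`x`-power torsion. Conversely, an invertible inverse image ideal together with such charts gives the
universal property.

Write `J` for the ideal of `Z₂` and `L` for that of `E₂`. The commutative square gives `J·𝒪 ⊆ L`,
and `L` lifts the invertible ideal `I·𝒪_Y` flatly. A lift `x ∈ J` of a local generator therefore
generates `L`, so `L = J·𝒪` is invertible (`IsDeformation.isGenerator_of`). The conditions defining
a blow-up algebra also lift modulo `p²` (`IsDeformation.isBlowupAlgebra`), so `Y₂` is the blow-up of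
`X₂` along `Z₂`.

If `F_X(J) ⊆ J^p`, then on a chart `F_X(x) = x^p u` with `u ≡ 1` modulo `p`. Hence `J` pulls back
along `π₂ ≫ F_X` to an invertible ideal, and the universal property yields `F_Y`; uniqueness of maps
into the blow-up shows that `F_Y` lifts Frobenius.

Conversely, write `F_X(x) = x^p + p a(x)`, where only `a(x)` modulo `p` matters. On the chart of
`x`, put `x' = x y` and `F_Y(y) = y^p + p b`. Comparing the two expressions for the image of `x'`
gives `a(x') = a(x) y^p + x^p b` modulo `p`. Clearing denominators gives `x^(N+p) a(x') - x'^p x^N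
a(x) ∈ I^(N+2p)`. A smooth center in a smooth scheme is locally cut out by a quasi-regular family,
with at least two members because the codimension exceeds one. Thus `x^N` cancels, and for two
members `x_i`, `x_j` the leading forms satisfy `X_i^p A_j = X_j^p A_i`. Forms of degree below `p`
must then vanish, so all `a(x)` lie in `I^p`, which is compatibility with `Z₂`. Compatibility with
`E₂` follows by pulling back along `π₂`, since `L = J·𝒪`. -/

namespace FrobLift

/-! ### Affine blow-up algebras -/

section BlowupAlgebra

variable {A B D : Type*} [CommRing A] [CommRing B] [CommRing D]

/-- The image of `x` is a non-zero-divisor which divides the image of every element of `I`. -/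
structure IsGenerator (φ : A →+* B) (I : Ideal A) (x : A) : Prop where
  mem_nonZeroDivisors : φ x ∈ nonZeroDivisors B
  dvd : ∀ a ∈ I, φ x ∣ φ a

/-- `φ : A → D` is the affine blow-up algebra `A[I/x]`. -/
structure IsBlowupAlgebra (φ : A →+* D) (I : Ideal A) (x : A) : Prop
    extends IsGenerator φ I x where
  exists_pow_mul : ∀ d, ∃ (n : ℕ) (b : A), b ∈ I ^ n ∧ φ x ^ n * d = φ b
  exists_pow_mul_eq_zero : ∀ a, φ a = 0 → ∃ n : ℕ, x ^ n * a = 0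

namespace IsGenerator

variable {φ : A →+* B} {I : Ideal A} {x : A}

theorem map_le (h : IsGenerator φ I x) : I.map φ ≤ Ideal.span {φ x} := by
  rw [Ideal.map_le_iff_le_comap]
  intro a ha
  exact Ideal.mem_span_singleton.mpr (h.dvd a ha)

theorem map_eq (h : IsGenerator φ I x) (hx : x ∈ I) : I.map φ = Ideal.span {φ x} :=
  le_antisymm h.map_le (by
    rw [Ideal.span_singleton_le_iff_mem]; exact Ideal.mem_map_of_mem φ hx)

theorem pow_dvd (h : IsGenerator φ I x) {n : ℕ} {b : A} (hb : b ∈ I ^ n) : φ x ^ n ∣ φ b := by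
  have h1 : φ b ∈ (I ^ n).map φ := Ideal.mem_map_of_mem φ hb
  rw [Ideal.map_pow] at h1
  have h2 := Ideal.pow_right_mono h.map_le n h1
  rwa [Ideal.span_singleton_pow, Ideal.mem_span_singleton] at h2

theorem cancel (h : IsGenerator φ I x) (n : ℕ) {b c : B} (hbc : φ x ^ n * b = φ x ^ n * c) :
    b = c :=
  (mul_cancel_left_mem_nonZeroDivisors (pow_mem h.mem_nonZeroDivisors n)).mp hbc

end IsGenerator

namespace IsBlowupAlgebra

variable {φ : A →+* D} {ψ : A →+* B} {I : Ideal A} {x : A}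

/-- The graph of the unique `A`-algebra map out of a blow-up algebra. -/
def LiftRel (φ : A →+* D) (ψ : A →+* B) (I : Ideal A) (x : A) (d : D) (b : B) : Prop :=
  ∃ (n : ℕ) (a : A), a ∈ I ^ n ∧ φ x ^ n * d = φ a ∧ ψ x ^ n * b = ψ a

/-- Two fractions for the same `d` cross-multiply to an element of the kernel of `φ`. A power of `x`
kills it, and `ψ x` is a non-zero-divisor, so the difference also vanishes in `B`. -/
theorem LiftRel.unique (hφ : IsBlowupAlgebra φ I x) (hψ : IsGenerator ψ I x) {d : D} {b b' : B}
    (h : LiftRel φ ψ I x d b) (h' : LiftRel φ ψ I x d b') : b = b' := by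
  obtain ⟨n, a, -, h1, h2⟩ := h
  obtain ⟨m, a', -, h1', h2'⟩ := h'
  obtain ⟨k, hk⟩ := hφ.exists_pow_mul_eq_zero (x ^ m * a - x ^ n * a') (by
    simp only [map_sub, map_mul, map_pow, ← h1, ← h1']; ring)
  have := congrArg ψ hk
  simp only [map_sub, map_mul, map_pow, ← h2, ← h2', map_zero] at this
  refine hψ.cancel (k + m + n) (sub_eq_zero.mp ?_)
  rw [← this]; ring

theorem LiftRel.exists (hφ : IsBlowupAlgebra φ I x) (hψ : IsGenerator ψ I x) (d : D) :
    ∃ b, LiftRel φ ψ I x d b := by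
  obtain ⟨n, a, ha, h⟩ := hφ.exists_pow_mul d
  obtain ⟨b, hb⟩ := hψ.pow_dvd ha
  exact ⟨b, n, a, ha, h, hb.symm⟩

theorem LiftRel.add {d d' : D} {b b' : B} (h : LiftRel φ ψ I x d b) (h' : LiftRel φ ψ I x d' b')
    (hx : x ∈ I) : LiftRel φ ψ I x (d + d') (b + b') := by
  obtain ⟨n, a, ha, h1, h2⟩ := h
  obtain ⟨m, a', ha', h1', h2'⟩ := h'
  refine ⟨n + m, x ^ m * a + x ^ n * a', Ideal.add_mem _ ?_ ?_, ?_, ?_⟩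
  · rw [add_comm n m, pow_add]; exact Ideal.mul_mem_mul (Ideal.pow_mem_pow hx m) ha
  · rw [pow_add]; exact Ideal.mul_mem_mul (Ideal.pow_mem_pow hx n) ha'
  · simp only [map_add, map_mul, map_pow, ← h1, ← h1']; ring
  · simp only [map_add, map_mul, map_pow, ← h2, ← h2']; ring

theorem LiftRel.mul {d d' : D} {b b' : B} (h : LiftRel φ ψ I x d b)
    (h' : LiftRel φ ψ I x d' b') : LiftRel φ ψ I x (d * d') (b * b') := by
  obtain ⟨n, a, ha, h1, h2⟩ := h
  obtain ⟨m, a', ha', h1', h2'⟩ := h'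
  refine ⟨n + m, a * a', ?_, ?_, ?_⟩
  · rw [pow_add]; exact Ideal.mul_mem_mul ha ha'
  · simp only [map_mul, ← h1, ← h1']; ring
  · simp only [map_mul, ← h2, ← h2']; ring

theorem LiftRel.map (φ : A →+* D) (ψ : A →+* B) (I : Ideal A) (x a : A) :
    LiftRel φ ψ I x (φ a) (ψ a) :=
  ⟨0, a, by simp, by simp, by simp⟩

theorem hom_ext (hφ : IsBlowupAlgebra φ I x) {f g : D →+* B} (hf : IsGenerator (f.comp φ) I x)
    (h : f.comp φ = g.comp φ) : f = g := by
  ext d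
  obtain ⟨n, a, -, h1⟩ := hφ.exists_pow_mul d
  refine hf.cancel n ?_
  have h2 := congrArg f h1
  have h3 := congrArg g h1
  simp only [map_mul, map_pow] at h2 h3
  have hx := RingHom.congr_fun h x
  have ha := RingHom.congr_fun h a
  simp only [RingHom.comp_apply] at hx ha ⊢
  rw [h2, hx, h3, ha]

/-- The universal property of affine blow-up algebras. -/
theorem exists_lift (hφ : IsBlowupAlgebra φ I x) (hx : x ∈ I) (hψ : IsGenerator ψ I x) :
    ∃ f : D →+* B, f.comp φ = ψ := by
  choose f hf using LiftRel.exists hφ hψ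
  have key : ∀ {d b}, LiftRel φ ψ I x d b → f d = b := fun h => (hf _).unique hφ hψ h
  have halg : ∀ a, f (φ a) = ψ a := fun a => key (LiftRel.map φ ψ I x a)
  refine ⟨⟨⟨⟨f, ?_⟩, ?_⟩, ?_, ?_⟩, RingHom.ext halg⟩
  · simpa using halg 1
  · exact fun d d' => key ((hf d).mul (hf d'))
  · simpa using halg 0
  · exact fun d d' => key ((hf d).add (hf d') hx)

/-- Affine blow-up algebras exist. -/
theorem exists_isBlowupAlgebra {A : Type u} [CommRing A] (I : Ideal A) {x : A} (hx : x ∈ I) :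
    ∃ (D : Type u) (_ : CommRing D) (φ : A →+* D), IsBlowupAlgebra φ I x := by
  let L := Localization.Away x
  let ι := algebraMap A L
  have hu : IsUnit (ι x) := IsLocalization.Away.algebraMap_isUnit x
  -- The fractions `b / x^n` with `b ∈ I^n` inside `A[1/x]`.
  let R : Subring L :=
    { carrier := {z | ∃ (n : ℕ) (b : A), b ∈ I ^ n ∧ ι x ^ n * z = ι b}
      mul_mem' := by
        rintro z z' ⟨n, b, hb, h⟩ ⟨m, b', hb', h'⟩
        refine ⟨n + m, b * b', ?_, ?_⟩
        · rw [pow_add]; exact Ideal.mul_mem_mul hb hb'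
        · rw [map_mul, ← h, ← h']; ring
      one_mem' := ⟨0, 1, by simp, by simp⟩
      zero_mem' := ⟨0, 0, by simp, by simp⟩
      add_mem' := by
        rintro z z' ⟨n, b, hb, h⟩ ⟨m, b', hb', h'⟩
        refine ⟨n + m, x ^ m * b + x ^ n * b', Ideal.add_mem _ ?_ ?_, ?_⟩
        · rw [add_comm n m, pow_add]; exact Ideal.mul_mem_mul (Ideal.pow_mem_pow hx m) hb
        · rw [pow_add]; exact Ideal.mul_mem_mul (Ideal.pow_mem_pow hx n) hb'
        · simp only [map_add, map_mul, map_pow, ← h, ← h']; ring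
      neg_mem' := by
        rintro z ⟨n, b, hb, h⟩
        exact ⟨n, -b, neg_mem hb, by rw [map_neg, ← h]; ring⟩ }
  have hι : ∀ a, ι a ∈ R := fun a => ⟨0, a, by simp, by simp⟩
  refine ⟨R, inferInstance, ι.codRestrict R hι, ⟨⟨?_, ?_⟩, ?_, ?_⟩⟩
  · rw [mem_nonZeroDivisors_iff_right]
    rintro ⟨z, hz⟩ h
    have h' : z * ι x = 0 := congrArg Subtype.val h
    exact Subtype.ext (hu.mul_left_eq_zero.mp h')
  · intro a ha
    obtain ⟨u, hu'⟩ := hu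
    have e : ι x * (↑u⁻¹ * ι a) = ι a := by rw [← hu', Units.mul_inv_cancel_left]
    exact ⟨(⟨(↑u⁻¹ : L) * ι a, 1, a, by simpa using ha, by rw [pow_one, e]⟩ : R),
      Subtype.ext e.symm⟩
  · rintro ⟨z, n, b, hb, h⟩
    exact ⟨n, b, hb, Subtype.ext h⟩
  · intro a ha
    have ha' : ι a = 0 := congrArg Subtype.val ha
    obtain ⟨⟨c, n, rfl⟩, hc⟩ := (IsLocalization.map_eq_zero_iff (Submonoid.powers x) L a).mp ha'
    exact ⟨n, hc⟩

end IsBlowupAlgebra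

end BlowupAlgebra

/-! ### Infinitesimal deformations of rings modulo `p²` -/

/-- `r : A → A₀` exhibits `A` as a flat lifting modulo `p ^ 2` of `A₀ = A / p`. -/
structure IsDeformation (p : ℕ) {A A₀ : Type*} [CommRing A] [CommRing A₀] (r : A →+* A₀) :
    Prop where
  surjective : Function.Surjective r
  natCast_eq_zero : (p : A₀) = 0
  exists_eq_mul : ∀ a, r a = 0 → ∃ b, a = (p : A) * b
  eq_zero_of_mul : ∀ a, (p : A) * a = 0 → r a = 0
  sq_eq_zero : (p : A) * p = 0

namespace IsDeformation

variable {p : ℕ} {A A₀ D D₀ : Type*} [CommRing A] [CommRing A₀] [CommRing D] [CommRing D₀]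
  {r : A →+* A₀} {rD : D →+* D₀} {φ : A →+* D} {φ₀ : A₀ →+* D₀}

theorem map_natCast_mul (hr : IsDeformation p r) (a : A) : r (p * a) = 0 := by
  rw [map_mul, map_natCast, hr.natCast_eq_zero, zero_mul]

theorem natCast_mul_eq_zero (hr : IsDeformation p r) {a : A} (h : r a = 0) : (p : A) * a = 0 := by
  obtain ⟨b, rfl⟩ := hr.exists_eq_mul a h
  rw [← mul_assoc, hr.sq_eq_zero, zero_mul]

theorem mul_congr (hr : IsDeformation p r) {a b : A} (h : r a = r b) : (p : A) * a = p * b := by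
  rw [← sub_eq_zero, ← mul_sub]
  exact hr.natCast_mul_eq_zero (by rw [map_sub, h, sub_self])

theorem eq_of_mul (hr : IsDeformation p r) {a b : A} (h : (p : A) * a = p * b) : r a = r b := by
  rw [← sub_eq_zero, ← map_sub]
  exact hr.eq_zero_of_mul _ (by rw [mul_sub, h, sub_self])

theorem exists_eq_add (hr : IsDeformation p r) {a b : A} (h : r a = r b) :
    ∃ c, a = b + p * c := by
  obtain ⟨c, hc⟩ := hr.exists_eq_mul (a - b) (by rw [map_sub, h, sub_self])
  exact ⟨c, by rw [← hc]; ring⟩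

theorem isUnit (hr : IsDeformation p r) {a : A} (h : IsUnit (r a)) : IsUnit a := by
  obtain ⟨b₀, hb⟩ := h.exists_right_inv
  obtain ⟨b, rfl⟩ := hr.surjective b₀
  obtain ⟨c, hc⟩ := hr.exists_eq_add (a := a * b) (b := 1) (by rw [map_mul, hb, map_one])
  -- Here `a b = 1 + p c`, whose inverse is `1 - p c` because `p² = 0`.
  refine IsUnit.of_mul_eq_one (b * (1 - p * c)) ?_
  have := hr.sq_eq_zero
  linear_combination (1 - (p : A) * c) * hc - c * c * this

/-- If `d x = 0`, cancelling modulo `p` gives `d = p e`. Then `p e x = 0` puts `e x` in `pA` by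
flatness, so `e ∈ pA` and `d ∈ p²A = 0`. -/
theorem mem_nonZeroDivisors (hr : IsDeformation p r) {x : A} (hx : r x ∈ nonZeroDivisors A₀) :
    x ∈ nonZeroDivisors A := by
  rw [mem_nonZeroDivisors_iff_right] at hx ⊢
  have key : ∀ d, r (d * x) = 0 → r d = 0 := fun d hd => hx _ (by rw [← map_mul, hd])
  intro d hd
  obtain ⟨e, rfl⟩ := hr.exists_eq_mul d (key d (by rw [hd, map_zero]))
  exact hr.natCast_mul_eq_zero (key e (hr.eq_zero_of_mul _ (by rw [← hd]; ring)))

theorem map_mem_nonZeroDivisors (hr : IsDeformation p r) {x : A} (hx : x ∈ nonZeroDivisors A) :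
    r x ∈ nonZeroDivisors A₀ := by
  rw [mem_nonZeroDivisors_iff_right] at hx ⊢
  intro d₀ hd
  obtain ⟨d, rfl⟩ := hr.surjective d₀
  rw [← map_mul] at hd
  exact hr.eq_zero_of_mul _ (hx _ (by rw [mul_assoc, hr.natCast_mul_eq_zero hd]))

/-- A generator of the reduction of a flat ideal lifts to a generator. -/
theorem dvd_of_mem (hr : IsDeformation p r) {L : Ideal A} {x : A} (hx : x ∈ L)
    (hL : ∀ z, (p : A) * z ∈ L → ∃ l ∈ L, (p : A) * z = p * l)
    (hdvd : ∀ l ∈ L, r x ∣ r l) {l : A} (hl : l ∈ L) : x ∣ l := by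
  have key : ∀ l ∈ L, ∃ y z, l = x * y + p * z := by
    intro l hl
    obtain ⟨y₀, hy⟩ := hdvd l hl
    obtain ⟨y, rfl⟩ := hr.surjective y₀
    obtain ⟨z, hz⟩ := hr.exists_eq_add (a := l) (b := x * y) (by rw [hy, map_mul])
    exact ⟨y, z, hz⟩
  obtain ⟨y, z, rfl⟩ := key l hl
  obtain ⟨l', hl', hz⟩ := hL z ((Ideal.add_mem_iff_right _ (L.mul_mem_right _ hx)).mp hl)
  -- A second correction suffices: the remaining error is `p² z' = 0`.
  obtain ⟨y', z', rfl⟩ := key l' hl'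
  refine ⟨y + p * y', ?_⟩
  rw [hz]
  have := hr.sq_eq_zero
  linear_combination z' * this

/-- The hypothesis `hL` says `pD ∩ L = pL`, that is, flatness of `D / L`. Hence an element of `L`
whose reduction generates the reduction of `L` already generates `L`. As `φ x` lies in the smaller
ideal `J·D`, both ideals equal `(φ x)`. -/
theorem isGenerator_of (hD : IsDeformation p rD) (comm : φ₀.comp r = rD.comp φ) {J : Ideal A}
    {I : Ideal A₀} {L : Ideal D} (hJL : J.map φ ≤ L)
    (hL : ∀ z, (p : D) * z ∈ L → ∃ l ∈ L, (p : D) * z = p * l)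
    (hLI : L.map rD = I.map φ₀) {x : A} (hxJ : x ∈ J) (hx : IsGenerator φ₀ I (r x)) :
    IsGenerator φ J x ∧ L = J.map φ := by
  have hc : ∀ a, φ₀ (r a) = rD (φ a) := fun a => RingHom.congr_fun comm a
  have hdvd : ∀ l ∈ L, φ x ∣ l := fun l hl => hD.dvd_of_mem (hJL (Ideal.mem_map_of_mem φ hxJ)) hL
    (fun l hl => by
      rw [← hc, ← Ideal.mem_span_singleton]
      exact hx.map_le (hLI ▸ Ideal.mem_map_of_mem rD hl)) hl
  have hgen : IsGenerator φ J x := ⟨hD.mem_nonZeroDivisors (by rw [← hc]; exact hx.1),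
    fun a ha => hdvd _ (hJL (Ideal.mem_map_of_mem φ ha))⟩
  refine ⟨hgen, le_antisymm (fun l hl => ?_) hJL⟩
  rw [hgen.map_eq hxJ]
  exact Ideal.mem_span_singleton.mpr (hdvd l hl)

theorem isGenerator_reduction (hD : IsDeformation p rD) (comm : φ₀.comp r = rD.comp φ)
    (hr : Function.Surjective r) {J : Ideal A} {x : A} (hx : IsGenerator φ J x) :
    IsGenerator φ₀ (J.map r) (r x) := by
  have hc : ∀ a, φ₀ (r a) = rD (φ a) := fun a => RingHom.congr_fun comm a
  refine ⟨by rw [hc]; exact hD.map_mem_nonZeroDivisors hx.1, fun a ha => ?_⟩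
  obtain ⟨b, hb, rfl⟩ := (Ideal.mem_map_iff_of_surjective r hr).mp ha
  rw [hc, hc]
  exact map_dvd rD (hx.dvd b hb)

theorem exists_mem_pow (hr : Function.Surjective r) {J : Ideal A} {n : ℕ} {b₀ : A₀}
    (hb : b₀ ∈ J.map r ^ n) : ∃ b ∈ J ^ n, r b = b₀ := by
  rw [← Ideal.map_pow] at hb
  obtain ⟨b, hb, h⟩ := (Ideal.mem_map_iff_of_surjective r hr).mp hb
  exact ⟨b, hb, h⟩

/-- Each condition is lifted by applying its reduction twice. An element is a fraction up to `p`
times a remainder, and the remainder is again a fraction up to `p`. If `φ a = 0`, then `x^m a = p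
b`, flatness puts `φ b` in `pD`, and `x^k b ∈ pA`; hence `x^(k+m) a ∈ p²A = 0`. -/
theorem isBlowupAlgebra (hr : IsDeformation p r) (hD : IsDeformation p rD)
    (comm : φ₀.comp r = rD.comp φ) {J : Ideal A} {x : A} (hxJ : x ∈ J)
    (hx : IsGenerator φ J x) (h₀ : IsBlowupAlgebra φ₀ (J.map r) (r x)) :
    IsBlowupAlgebra φ J x := by
  have hc : ∀ a, φ₀ (r a) = rD (φ a) := fun a => RingHom.congr_fun comm a
  have key : ∀ d, ∃ (n : ℕ) (b : A) (d' e : D), b ∈ J ^ n ∧ φ x ^ n * d' = φ b ∧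
      d = d' + p * e := by
    intro d
    obtain ⟨n, b₀, hb₀, h⟩ := h₀.exists_pow_mul (rD d)
    obtain ⟨b, hb, rfl⟩ := exists_mem_pow hr.surjective hb₀
    obtain ⟨d', hd'⟩ := hx.pow_dvd hb
    obtain ⟨e, he⟩ := hD.exists_eq_add (a := d) (b := d') (h₀.cancel n (by
      rw [h, hc, hd', map_mul, map_pow, ← hc]))
    exact ⟨n, b, d', e, hb, hd'.symm, he⟩
  refine ⟨hx, fun d => ?_, fun a ha => ?_⟩
  · obtain ⟨n, b, d', e, hb, h, rfl⟩ := key d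
    obtain ⟨m, c, e', f, hc', h', rfl⟩ := key e
    refine ⟨n + m, x ^ m * b + p * (x ^ n * c), Ideal.add_mem _ ?_ (Ideal.mul_mem_left _ _ ?_), ?_⟩
    · rw [add_comm n m, pow_add]; exact Ideal.mul_mem_mul (Ideal.pow_mem_pow hxJ m) hb
    · rw [pow_add]; exact Ideal.mul_mem_mul (Ideal.pow_mem_pow hxJ n) hc'
    · simp only [map_add, map_mul, map_pow, ← h, ← h', map_natCast]
      have := hD.sq_eq_zero
      linear_combination φ x ^ (n + m) * f * this
  · obtain ⟨m, hm⟩ := h₀.exists_pow_mul_eq_zero (r a) (by rw [hc, ha, map_zero])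
    rw [← map_pow, ← map_mul] at hm
    obtain ⟨b, hb⟩ := hr.exists_eq_mul _ hm
    have hb' : (p : D) * φ b = 0 := by
      rw [← map_natCast φ p, ← map_mul, ← hb, map_mul, ha, mul_zero]
    obtain ⟨k, hk⟩ := h₀.exists_pow_mul_eq_zero (r b) (by rw [hc]; exact hD.eq_zero_of_mul _ hb')
    rw [← map_pow, ← map_mul] at hk
    refine ⟨k + m, ?_⟩
    rw [pow_add, mul_assoc, hb]
    linear_combination hr.natCast_mul_eq_zero hk

end IsDeformation


/-! ### Sections over open subsets -/

section Sections

variable {X Y T : Scheme.{u}}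

/-- Restriction of sections. -/
abbrev res {U V : X.Opens} (h : V ≤ U) : Γ(X, U) →+* Γ(X, V) :=
  (X.presheaf.map (homOfLE h).op).hom

/-- Pullback of sections from `U` to `V ⊆ g⁻¹ U`. -/
abbrev pull (g : T ⟶ X) {U : X.Opens} {V : T.Opens} (e : V ≤ g ⁻¹ᵁ U) : Γ(X, U) →+* Γ(T, V) :=
  (g.appLE U V e).hom

theorem res_res {U V W : X.Opens} (h : V ≤ U) (h' : W ≤ V) (x : Γ(X, U)) :
    res h' (res h x) = res (h'.trans h) x := by
  simp only [res, ← CommRingCat.comp_apply, ← Functor.map_comp]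
  rfl

theorem res_self {U : X.Opens} (h : U ≤ U) (x : Γ(X, U)) : res h x = x := by
  simp [res]

theorem res_pull (g : T ⟶ X) {U : X.Opens} {V W : T.Opens} (e : V ≤ g ⁻¹ᵁ U) (h : W ≤ V)
    (x : Γ(X, U)) : res h (pull g e x) = pull g (h.trans e) x := by
  simp only [res, pull, ← CommRingCat.comp_apply, Scheme.Hom.appLE_map]

theorem pull_res (g : T ⟶ X) {U U' : X.Opens} {V : T.Opens} (h : U' ≤ U) (e : V ≤ g ⁻¹ᵁ U')
    (x : Γ(X, U)) :
    pull g e (res h x) = pull g (e.trans (fun _ hy => h hy)) x := by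
  simp only [res, pull, ← CommRingCat.comp_apply, Scheme.Hom.map_appLE]

theorem pull_pull (f : T ⟶ Y) (g : Y ⟶ X) {U : X.Opens} {V : Y.Opens} {W : T.Opens}
    (e : V ≤ g ⁻¹ᵁ U) (e' : W ≤ f ⁻¹ᵁ V) (x : Γ(X, U)) :
    pull f e' (pull g e x) = pull (f ≫ g) (e'.trans (fun _ hy => e hy)) x := by
  simp only [pull, ← CommRingCat.comp_apply, Scheme.Hom.appLE_comp_appLE]

theorem section_ext {ι : Type u} {W : T.Opens} (V : ι → T.Opens) (hV : ∀ i, V i ≤ W)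
    (hW : W ≤ iSup V) {s t : Γ(T, W)} (h : ∀ i, res (hV i) s = res (hV i) t) : s = t :=
  T.sheaf.eq_of_locally_eq' V W (fun i => homOfLE (hV i)) hW s t h

theorem section_glue {ι : Type u} {W : T.Opens} (V : ι → T.Opens) (hV : ∀ i, V i ≤ W)
    (hW : W ≤ iSup V) (s : ∀ i, Γ(T, V i))
    (h : ∀ i j, res (inf_le_left : V i ⊓ V j ≤ V i) (s i) = res inf_le_right (s j)) :
    ∃ t : Γ(T, W), ∀ i, res (hV i) t = s i :=
  (T.sheaf.existsUnique_gluing' V W (fun i => homOfLE (hV i)) hW s h).exists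

theorem mem_nonZeroDivisors_of_cover {ι : Type u} {W : T.Opens} (V : ι → T.Opens)
    (hV : ∀ i, V i ≤ W) (hW : W ≤ iSup V) {s : Γ(T, W)}
    (h : ∀ i, res (hV i) s ∈ nonZeroDivisors Γ(T, V i)) : s ∈ nonZeroDivisors Γ(T, W) := by
  rw [mem_nonZeroDivisors_iff_right]
  intro t ht
  refine section_ext V hV hW fun i => ?_
  rw [map_zero]
  exact (mem_nonZeroDivisors_iff_right.mp (h i)) _ (by rw [← map_mul, ht, map_zero])

/-- The local quotients agree on overlaps because `s` is a non-zero-divisor there, so they glue. -/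
theorem dvd_of_cover {ι : Type u} {W : T.Opens} (V : ι → T.Opens)
    (hV : ∀ i, V i ≤ W) (hW : W ≤ iSup V) {s a : Γ(T, W)}
    (h : ∀ i j, res (inf_le_left.trans (hV i) : V i ⊓ V j ≤ W) s ∈
      nonZeroDivisors Γ(T, V i ⊓ V j))
    (hd : ∀ i, res (hV i) s ∣ res (hV i) a) : s ∣ a := by
  choose c hc using hd
  obtain ⟨t, ht⟩ := section_glue V hV hW c fun i j => by
    refine (mul_cancel_left_mem_nonZeroDivisors (h i j)).mp ?_
    have h1 := congrArg (res (inf_le_left : V i ⊓ V j ≤ V i)) (hc i)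
    have h2 := congrArg (res (inf_le_right : V i ⊓ V j ≤ V j)) (hc j)
    rw [map_mul, res_res, res_res] at h1 h2
    rw [← h1, ← h2]
  exact ⟨t, section_ext V hV hW fun i => by rw [map_mul, ht, hc]⟩

theorem res_basicOpen_mem_nonZeroDivisors {W : T.Opens} (hW : IsAffineOpen W) (f : Γ(T, W))
    {s : Γ(T, W)} (hs : s ∈ nonZeroDivisors Γ(T, W)) :
    res (T.basicOpen_le f) s ∈ nonZeroDivisors Γ(T, T.basicOpen f) :=
  have := hW.isLocalization_basicOpen f
  IsLocalization.nonZeroDivisors_le_comap (Submonoid.powers f) Γ(T, T.basicOpen f) hs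

end Sections

/-! ### Local generators of inverse image ideals -/

section GeneratorOn

variable {X T : Scheme.{u}} (g : T ⟶ X) {U : X.Opens} (I : Ideal Γ(X, U)) (x : Γ(X, U))

/-- On `W ⊆ g⁻¹ U`, the inverse image of the ideal `I` is generated by the non-zero-divisor `x`. -/
def IsGeneratorOn (W : T.Opens) : Prop :=
  ∃ e : W ≤ g ⁻¹ᵁ U, ∀ (W' : T.Opens) (h : W' ≤ W), IsGenerator (pull g (h.trans e)) I x

variable {g I x}

theorem IsGeneratorOn.le {W : T.Opens} (h : IsGeneratorOn g I x W) : W ≤ g ⁻¹ᵁ U := h.1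

theorem IsGeneratorOn.isGenerator {W : T.Opens} (h : IsGeneratorOn g I x W) (e : W ≤ g ⁻¹ᵁ U) :
    IsGenerator (pull g e) I x := h.2 W le_rfl

theorem IsGeneratorOn.mono {W W' : T.Opens} (h : IsGeneratorOn g I x W) (hW : W' ≤ W) :
    IsGeneratorOn g I x W' :=
  ⟨hW.trans h.1, fun V hV => h.2 V (hV.trans hW)⟩

theorem IsGenerator.of_cover {ι : Type u} {W : T.Opens} (e : W ≤ g ⁻¹ᵁ U) (V : ι → T.Opens)
    (hV : ∀ i, V i ≤ W) (hW : W ≤ iSup V)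
    (h : ∀ i, IsGenerator (pull g ((hV i).trans e)) I x)
    (h' : ∀ i j, pull g ((inf_le_left.trans (hV i)).trans e) x ∈
      nonZeroDivisors Γ(T, V i ⊓ V j)) : IsGenerator (pull g e) I x := by
  refine ⟨mem_nonZeroDivisors_of_cover V hV hW fun i => ?_,
    fun a ha => dvd_of_cover V hV hW (fun i j => ?_) fun i => ?_⟩
  · rw [res_pull]; exact (h i).1
  · rw [res_pull]; exact h' i j
  · rw [res_pull, res_pull]; exact (h i).2 a ha

theorem IsGeneratorOn.of_forall_mem {W : T.Opens}
    (h : ∀ t ∈ W, ∃ V : T.Opens, t ∈ V ∧ IsGeneratorOn g I x V) : IsGeneratorOn g I x W := by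
  choose! V hV hV' using h
  refine ⟨fun t ht => (hV' t ht).le (hV t ht), fun W' hW' => ?_⟩
  refine IsGenerator.of_cover (ι := W') _ (fun t => V t.1 ⊓ W') (fun _ => inf_le_right)
    (fun t ht => ?_) (fun t => ?_) (fun t s => ?_)
  · exact Opens.mem_iSup.mpr ⟨⟨t, ht⟩, hV t (hW' ht), ht⟩
  · exact ((hV' t.1 (hW' t.2)).mono inf_le_left).isGenerator _
  · exact (((hV' t.1 (hW' t.2)).mono (inf_le_left.trans inf_le_left)).isGenerator _).1

/-- Localization preserves non-zero-divisors and divisibility, and every smaller open is covered by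
basic opens of `W` whose intersections are again basic. A single check on `W` therefore suffices. -/
theorem IsGeneratorOn.of_isAffineOpen {W : T.Opens} (hW : IsAffineOpen W) (e : W ≤ g ⁻¹ᵁ U)
    (h : IsGenerator (pull g e) I x) : IsGeneratorOn g I x W := by
  have hb : ∀ f : Γ(T, W), IsGenerator (pull g ((T.basicOpen_le f).trans e)) I x := by
    refine fun f => ⟨?_, fun a ha => ?_⟩
    · rw [← res_pull g e]; exact res_basicOpen_mem_nonZeroDivisors hW f h.1
    · rw [← res_pull g e (T.basicOpen_le f), ← res_pull g e (T.basicOpen_le f)]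
      exact map_dvd (res (T.basicOpen_le f)) (h.2 a ha)
  refine ⟨e, fun W' hW' => ?_⟩
  have := fun t : W' => hW.exists_basicOpen_le t (hW' t.2)
  choose f hf hf' using this
  refine IsGenerator.of_cover (ι := W') _ (fun t => T.basicOpen (f t)) hf
    (fun t ht => Opens.mem_iSup.mpr ⟨⟨t, ht⟩, hf' ⟨t, ht⟩⟩) (fun t => hb _) (fun t s => ?_)
  have key : ∀ (V : T.Opens) (hV : V ≤ g ⁻¹ᵁ U), V = T.basicOpen (f t * f s) →
      pull g hV x ∈ nonZeroDivisors Γ(T, V) := by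
    rintro V hV rfl
    exact (hb _).1
  exact key _ _ (T.basicOpen_mul _ _).symm

theorem IsGeneratorOn.comp {S : Scheme.{u}} (f : S ⟶ T) [IsOpenImmersion f] {W : T.Opens}
    (h : IsGeneratorOn g I x W) : IsGeneratorOn (f ≫ g) I x (f ⁻¹ᵁ W) := by
  refine ⟨fun t ht => h.le ht, fun V hV => ?_⟩
  have h1 : f ''ᵁ V ≤ W := by
    rintro _ ⟨t, ht, rfl⟩
    exact hV ht
  have h2 := h.2 _ h1
  have h3 : V ≤ f ⁻¹ᵁ f ''ᵁ V := (f.preimage_image_eq V).ge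
  have h4 : Function.Bijective (pull f h3) := by
    rw [pull, ← f.appIso_hom']
    exact ConcreteCategory.bijective_of_isIso _
  refine ⟨?_, fun a ha => ?_⟩
  · rw [← pull_pull f g (h1.trans h.1) h3, mem_nonZeroDivisors_iff_right]
    intro s hs
    obtain ⟨s, rfl⟩ := h4.2 s
    rw [← map_mul] at hs
    rw [mem_nonZeroDivisors_iff_right.mp h2.1 s (h4.1 (by rw [hs, map_zero])), map_zero]
  · rw [← pull_pull f g (h1.trans h.1) h3, ← pull_pull f g (h1.trans h.1) h3]
    exact map_dvd _ (h2.2 a ha)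

end GeneratorOn

/-! ### Inverse image ideals on affine open subsets -/

section Comap

variable {X Y T : Scheme.{u}}

theorem appTop_eq_pull (f : T ⟶ X) :
    f.appTop.hom = pull f (U := ⊤) (V := ⊤) f.preimage_top.ge := by
  change _ = (f.appLE ⊤ (f ⁻¹ᵁ ⊤) le_rfl).hom
  rw [Scheme.Hom.appLE_eq_app]
  rfl

/-- Inverse image of ideal sheaves is left adjoint to direct image, and between affine schemes the
direct image is contraction of ideals. The two inclusions are the two halves of the adjunction. -/
theorem ideal_comap_of_isAffine [IsAffine X] [IsAffine T] (I : X.IdealSheafData) (f : T ⟶ X) :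
    (I.comap f).ideal ⟨⊤, isAffineOpen_top T⟩ =
      (I.ideal ⟨⊤, isAffineOpen_top X⟩).map (f.appTop).hom := by
  apply le_antisymm
  · have h : I.comap f ≤ Scheme.IdealSheafData.ofIdealTop
        ((I.ideal ⟨⊤, isAffineOpen_top X⟩).map (f.appTop).hom) := by
      rw [← Scheme.IdealSheafData.le_map_iff_comap_le]
      refine Scheme.IdealSheafData.le_of_isAffine ?_
      rw [Scheme.IdealSheafData.ideal_map_of_isAffineHom]
      refine Ideal.le_comap_map.trans (Ideal.comap_mono ?_)
      exact ((Scheme.IdealSheafData.equivOfIsAffine (X := T)).right_inv _).ge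
    exact (h _).trans ((Scheme.IdealSheafData.equivOfIsAffine (X := T)).right_inv _).le
  · have h := Scheme.IdealSheafData.le_map_comap (J := I) (f := f) ⟨⊤, isAffineOpen_top X⟩
    rw [Scheme.IdealSheafData.ideal_map_of_isAffineHom] at h
    exact Ideal.map_le_iff_le_comap.mpr h

theorem ideal_comap_isOpenImmersion (I : X.IdealSheafData) (f : T ⟶ X) [IsOpenImmersion f]
    (U : X.affineOpens) (W : T.affineOpens) (e : W.1 ≤ f ⁻¹ᵁ U.1) :
    (I.comap f).ideal W = (I.ideal U).map (pull f e) := by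
  have hle : f ''ᵁ W.1 ≤ U.1 := by
    rintro _ ⟨t, ht, rfl⟩
    exact e ht
  rw [Scheme.IdealSheafData.ideal_comap_of_isOpenImmersion,
    ← Scheme.IdealSheafData.map_ideal I
      (U := ⟨f ''ᵁ W.1, W.2.image_of_isOpenImmersion f⟩) (V := U) hle]
  let α : Γ(X, f ''ᵁ W.1) ≃+* Γ(T, W.1) := (f.appIso W.1).commRingCatIsoToRingEquiv
  have h1 : (f.appIso W.1).inv.hom = (α.symm : _ →+* _) := rfl
  have h2 : pull f e = (α : _ →+* _).comp (res hle) := by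
    ext a
    have : (α : _ →+* _) = pull f (f.preimage_image_eq W.1).ge := by
      rw [pull, ← f.appIso_hom']; rfl
    rw [this, RingHom.comp_apply, pull_res]
  rw [h1, h2, ← Ideal.map_map]
  exact Ideal.comap_symm α

theorem ideal_comap (I : X.IdealSheafData) (g : T ⟶ X) (U : X.affineOpens) (W : T.affineOpens)
    (e : W.1 ≤ g ⁻¹ᵁ U.1) : (I.comap g).ideal W = (I.ideal U).map (pull g e) := by
  have : IsAffine U.1 := U.2
  have : IsAffine W.1 := W.2
  have hW : (⊤ : W.1.toScheme.Opens) ≤ W.1.ι ⁻¹ᵁ W.1 := W.1.ι_preimage_self.ge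
  have hU : (⊤ : U.1.toScheme.Opens) ≤ U.1.ι ⁻¹ᵁ U.1 := U.1.ι_preimage_self.ge
  have h1 := ideal_comap_isOpenImmersion (I.comap g) W.1.ι W ⟨⊤, isAffineOpen_top _⟩ hW
  have h2 := ideal_comap_isOpenImmersion I U.1.ι U ⟨⊤, isAffineOpen_top _⟩ hU
  have h3 := ideal_comap_of_isAffine (I.comap U.1.ι) (g.resLE U.1 W.1 e)
  rw [h2, Ideal.map_map, ← Scheme.IdealSheafData.comap_comp, Scheme.Hom.resLE_comp_ι,
    Scheme.IdealSheafData.comap_comp, h1] at h3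
  have h4 : Function.Bijective (pull W.1.ι hW) := ConcreteCategory.bijective_of_isIso _
  have h5 : ((g.resLE U.1 W.1 e).appTop.hom).comp (pull U.1.ι hU) =
      (pull W.1.ι hW).comp (pull g e) := by
    ext a
    rw [RingHom.comp_apply, appTop_eq_pull, RingHom.comp_apply, pull_pull, pull_pull]
    simp only [Scheme.Hom.resLE_comp_ι]
  rw [h5, ← Ideal.map_map] at h3
  have h6 := congrArg (Ideal.comap (pull W.1.ι hW)) h3
  rwa [Ideal.comap_map_of_bijective _ h4, Ideal.comap_map_of_bijective _ h4] at h6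

variable {g : T ⟶ X} {I : X.IdealSheafData}

theorem exists_isAffineOpen_le {t : T} {V : T.Opens} (ht : t ∈ V) :
    ∃ W : T.Opens, IsAffineOpen W ∧ t ∈ W ∧ W ≤ V :=
  AlgebraicGeometry.exists_isAffineOpen_mem_and_subset ht

/-- The local generator can be taken from `I` itself. If `I·𝒪 = (f)` and `a = f c_a` for `a ∈ I`,
cancelling `f` shows that the `c_a` generate the unit ideal. Some `c_a` is invertible near `t`, and
there `a` generates. -/
theorem exists_isGeneratorOn (h : IsInvertibleIdeal (I.comap g)) (t : T) (U : X.affineOpens)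
    (hU : g t ∈ U.1) : ∃ x ∈ I.ideal U, ∃ W : T.Opens, IsAffineOpen W ∧ t ∈ W ∧
      IsGeneratorOn g (I.ideal U) x W := by
  obtain ⟨V, htV, f, hf, hVf⟩ := h t
  obtain ⟨r, hr, htr⟩ := V.2.exists_basicOpen_le (V := V.1 ⊓ g ⁻¹ᵁ U.1) ⟨t, htV, hU⟩ htV
  let V' : T.affineOpens := ⟨T.basicOpen r, V.2.basicOpen r⟩
  have e : V'.1 ≤ g ⁻¹ᵁ U.1 := hr.trans inf_le_right
  have hf' := res_basicOpen_mem_nonZeroDivisors V.2 r hf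
  have hV' := (ideal_comap I g U V' e).symm.trans
    (Scheme.IdealSheafData.map_ideal (I.comap g) (U := V') (V := V) (T.basicOpen_le r)).symm
  rw [hVf, Ideal.map_span, Set.image_singleton] at hV'
  set f' := res (T.basicOpen_le r) f with hf'def
  have hdvd : ∀ a ∈ I.ideal U, f' ∣ pull g e a := fun a ha =>
    Ideal.mem_span_singleton.mp (hV'.le (Ideal.mem_map_of_mem _ ha))
  choose! c hc using hdvd
  have hspan : Ideal.span (c '' (I.ideal U : Set Γ(X, U.1))) = ⊤ := by
    have h1 : Ideal.span {f'} ≤ Ideal.span {f'} * Ideal.span (c '' (I.ideal U)) := by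
      refine hV'.ge.trans ?_
      rw [Ideal.map_le_iff_le_comap]
      intro a ha
      rw [Ideal.mem_comap, hc a ha]
      exact Ideal.mul_mem_mul (Ideal.mem_span_singleton_self _)
        (Ideal.subset_span ⟨a, ha, rfl⟩)
    have h2 := h1 (Ideal.mem_span_singleton_self f')
    rw [Ideal.mem_span_singleton_mul] at h2
    obtain ⟨z, hz, hz'⟩ := h2
    have : z = 1 := (mul_cancel_left_mem_nonZeroDivisors hf').mp (by rw [hz', mul_one])
    rwa [this, ← Ideal.eq_top_iff_one] at hz
  have hcov := (V'.2.self_le_iSup_basicOpen_iff (s := c '' (I.ideal U))).mpr hspan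
  obtain ⟨⟨_, a, ha, rfl⟩, hta⟩ := Opens.mem_iSup.mp (hcov htr)
  refine ⟨a, ha, T.basicOpen (c a), V'.2.basicOpen _, hta,
    IsGeneratorOn.of_isAffineOpen (V'.2.basicOpen _) ((T.basicOpen_le _).trans e) ?_⟩
  have hunit : IsUnit (res (T.basicOpen_le (c a)) (c a)) :=
    RingedSpace.isUnit_res_basicOpen _ (c a)
  refine ⟨?_, fun b hb => ?_⟩
  · rw [← res_pull g e (T.basicOpen_le (c a)), hc a ha, map_mul]
    exact mul_mem (res_basicOpen_mem_nonZeroDivisors V'.2 _ hf') hunit.mem_nonZeroDivisors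
  · rw [← res_pull g e (T.basicOpen_le (c a)), ← res_pull g e (T.basicOpen_le (c a)), hc a ha,
      hc b hb, map_mul, map_mul]
    refine mul_dvd_mul_left _ (hunit.dvd)

theorem isInvertibleIdeal_of (h : ∀ t : T, ∃ (U : X.affineOpens) (x : Γ(X, U.1)) (W : T.Opens),
    x ∈ I.ideal U ∧ t ∈ W ∧ IsGeneratorOn g (I.ideal U) x W) : IsInvertibleIdeal (I.comap g) := by
  intro t
  obtain ⟨U, x, W, hx, ht, hgen⟩ := h t
  obtain ⟨V, hV, htV, hVW⟩ := exists_isAffineOpen_le ht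
  refine ⟨⟨V, hV⟩, htV, _, ((hgen.mono hVW).isGenerator (hVW.trans hgen.le)).1, ?_⟩
  rw [ideal_comap I g U ⟨V, hV⟩ (hVW.trans hgen.le)]
  exact ((hgen.mono hVW).isGenerator (hVW.trans hgen.le)).map_eq hx

theorem IsInvertibleIdeal.comp {S : Scheme.{u}} (f : S ⟶ T) [IsOpenImmersion f]
    (h : IsInvertibleIdeal (I.comap g)) : IsInvertibleIdeal (I.comap (f ≫ g)) := by
  refine isInvertibleIdeal_of fun t => ?_
  obtain ⟨U, hU, ht, -⟩ := exists_isAffineOpen_le (Opens.mem_top (g (f t)))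
  obtain ⟨x, hx, W, -, htW, hgen⟩ := exists_isGeneratorOn h (f t) ⟨U, hU⟩ ht
  exact ⟨⟨U, hU⟩, x, f ⁻¹ᵁ W, hx, htW, hgen.comp f⟩

end Comap


/-! ### Morphisms into an affine open subscheme -/

section AffineTarget

variable {X Y T : Scheme.{u}}

theorem pull_congr {f g : T ⟶ Y} (h : f = g) {V : Y.Opens} {W : T.Opens} (e : W ≤ f ⁻¹ᵁ V)
    (e' : W ≤ g ⁻¹ᵁ V) (a : Γ(Y, V)) : pull f e a = pull g e' a := by
  subst h; rfl

theorem pull_id {V W : T.Opens} (e : W ≤ (𝟙 T) ⁻¹ᵁ V) (e' : W ≤ V) (a : Γ(T, V)) :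
    pull (𝟙 T) e a = res e' a := by
  change (𝟙 _ ≫ T.presheaf.map (homOfLE e).op).hom a = _
  rw [Category.id_comp]
  rfl

theorem ι_comp_eq_of_pull_eq {f g : T ⟶ Y} {V : Y.Opens} (hV : IsAffineOpen V) {W : T.Opens}
    (hf : W ≤ f ⁻¹ᵁ V) (hg : W ≤ g ⁻¹ᵁ V) (h : pull f hf = pull g hg) : W.ι ≫ f = W.ι ≫ g := by
  refine Scheme.hom_ext_of_forall _ _ fun t => ?_
  obtain ⟨W', hW', ht, hle⟩ := exists_isAffineOpen_le (Opens.mem_top t)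
  refine ⟨W', ht, ?_⟩
  have key : hW'.fromSpec ≫ W.ι ≫ f = hW'.fromSpec ≫ W.ι ≫ g := by
    have hf' : W' ≤ (W.ι ≫ f) ⁻¹ᵁ V := fun t _ => hf t.2
    have hg' : W' ≤ (W.ι ≫ g) ⁻¹ᵁ V := fun t _ => hg t.2
    rw [← hV.SpecMap_appLE_fromSpec (W.ι ≫ f) hW' hf', ← hV.SpecMap_appLE_fromSpec (W.ι ≫ g) hW' hg']
    congr 2
    have e : W' ≤ W.ι ⁻¹ᵁ W := fun t _ => t.2
    ext a
    change pull (W.ι ≫ f) hf' a = pull (W.ι ≫ g) hg' a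
    rw [← pull_pull W.ι f hf e, ← pull_pull W.ι g hg e, h]
  have hι : W'.ι = hW'.isoSpec.hom ≫ hW'.fromSpec := by simp
  rw [hι, Category.assoc, key, Category.assoc]

theorem hom_eq_of_pull_eq {f g : T ⟶ Y} {V : Y.Opens} (hV : IsAffineOpen V)
    (hf : ⊤ ≤ f ⁻¹ᵁ V) (hg : ⊤ ≤ g ⁻¹ᵁ V) (h : pull f hf = pull g hg) : f = g := by
  have := ι_comp_eq_of_pull_eq hV hf hg h
  exact (cancel_epi T.topIso.hom).mp this

theorem exists_hom_of_ringHom {V : Y.Opens} (hV : IsAffineOpen V) (ψ : Γ(Y, V) →+* Γ(T, ⊤)) :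
    ∃ (f : T ⟶ Y) (e : ⊤ ≤ f ⁻¹ᵁ V), pull f e = ψ := by
  have e₁ : ⊤ ≤ hV.fromSpec ⁻¹ᵁ V := hV.fromSpec_preimage_self.ge
  let f₂ := T.toSpecΓ ≫ Spec.map (CommRingCat.ofHom ψ)
  refine ⟨f₂ ≫ hV.fromSpec, fun t _ => e₁ (Opens.mem_top (f₂ t)), ?_⟩
  have h₁ : hV.fromSpec.appLE V ⊤ e₁ = (Scheme.ΓSpecIso Γ(Y, V)).inv := by
    rw [Scheme.Hom.appLE, hV.fromSpec_app_self, Category.assoc, ← Functor.map_comp]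
    exact (congrArg _ (CategoryTheory.Functor.map_id _ _)).trans (Category.comp_id _)
  have h₂ : f₂.appTop = (Scheme.ΓSpecIso Γ(Y, V)).hom ≫ CommRingCat.ofHom ψ := by
    rw [Scheme.Hom.comp_appTop, Scheme.toSpecΓ_appTop, Scheme.ΓSpecIso_naturality]
    rfl
  ext a
  rw [← pull_pull f₂ hV.fromSpec e₁ f₂.preimage_top.ge, ← appTop_eq_pull, h₂, pull, h₁,
    ← CommRingCat.comp_apply]
  simp

theorem pull_ι_bijective (W : T.Opens) :
    Function.Bijective (pull W.ι W.ι_preimage_self.ge : Γ(T, W) →+* Γ(W, ⊤)) :=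
  ConcreteCategory.bijective_of_isIso _

end AffineTarget

/-! ### Charts of a blow-up -/

section Transport

variable {A B C : Type*} [CommRing A] [CommRing B] [CommRing C] {φ : A →+* B} {I : Ideal A} {x : A}

theorem IsGenerator.of_bijective_comp {α : B →+* C} (hα : Function.Bijective α)
    (h : IsGenerator (α.comp φ) I x) : IsGenerator φ I x := by
  refine ⟨mem_nonZeroDivisors_iff_right.mpr fun b hb => hα.1 ?_, fun a ha => ?_⟩
  · rw [map_zero]
    refine mem_nonZeroDivisors_iff_right.mp h.1 _ ?_
    rw [RingHom.comp_apply, ← map_mul, hb, map_zero]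
  · obtain ⟨c, hc⟩ := h.2 a ha
    obtain ⟨b, rfl⟩ := hα.2 c
    exact ⟨b, hα.1 (by rw [map_mul]; exact hc)⟩

theorem IsBlowupAlgebra.of_bijective_comp {α : B →+* C} (hα : Function.Bijective α)
    (h : IsBlowupAlgebra (α.comp φ) I x) : IsBlowupAlgebra φ I x := by
  refine ⟨h.1.of_bijective_comp hα, fun b => ?_, fun a ha => h.3 a ?_⟩
  · obtain ⟨n, a, ha, hab⟩ := h.2 (α b)
    exact ⟨n, a, ha, hα.1 (by rw [map_mul, map_pow]; exact hab)⟩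
  · rw [RingHom.comp_apply, ha, map_zero]

theorem IsBlowupAlgebra.bijective_comp (h : IsBlowupAlgebra φ I x) (α : B ≃+* C) :
    IsBlowupAlgebra ((α : B →+* C).comp φ) I x := by
  refine IsBlowupAlgebra.of_bijective_comp α.symm.bijective (α := (α.symm : C →+* B)) ?_
  have : (α.symm : C →+* B).comp ((α : B →+* C).comp φ) = φ := by ext; simp
  rwa [this]

end Transport

section Charts

variable {X Y T : Scheme.{u}} {π : Y ⟶ X} {I : X.IdealSheafData}

/-- The largest open subset on which `x` generates the inverse image of `I`. -/
def generatorLocus (π : Y ⟶ X) {U : X.Opens} (I : Ideal Γ(X, U)) (x : Γ(X, U)) : Y.Opens :=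
  sSup {W | IsGeneratorOn π I x W}

theorem IsGeneratorOn.le_generatorLocus {U : X.Opens} {I : Ideal Γ(X, U)} {x : Γ(X, U)}
    {W : Y.Opens} (h : IsGeneratorOn π I x W) : W ≤ generatorLocus π I x :=
  le_sSup h

theorem isGeneratorOn_generatorLocus (π : Y ⟶ X) {U : X.Opens} (I : Ideal Γ(X, U))
    (x : Γ(X, U)) : IsGeneratorOn π I x (generatorLocus π I x) := by
  refine IsGeneratorOn.of_forall_mem fun t ht => ?_
  obtain ⟨W, hW, htW⟩ := Opens.mem_sSup.mp ht
  exact ⟨W, htW, hW⟩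

/-- A morphism lands in the locus where a given element generates the inverse image ideal, as soon
as this element generates the inverse image ideal on the source. -/
theorem le_preimage_generatorLocus (hπ : IsInvertibleIdeal (I.comap π)) (h : T ⟶ Y)
    {U : X.affineOpens} {x : Γ(X, U.1)} (hx : x ∈ I.ideal U) {W : T.Opens}
    (hW : IsGeneratorOn (h ≫ π) (I.ideal U) x W) :
    W ≤ h ⁻¹ᵁ generatorLocus π (I.ideal U) x := by
  intro t ht
  obtain ⟨x', hx', V, hV, htV, hgen⟩ := exists_isGeneratorOn hπ (h t) U (hW.le ht)
  have hgen' := hgen.isGenerator hgen.le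
  -- Near `h t` one has `x = x' c`. Both elements generate after pulling back to `W'`, so `c` pulls
  -- back to a unit. Thus `h t` lies in `D(c)`, where `x` generates as well as `x'`.
  obtain ⟨c, hc⟩ := hgen'.dvd x hx
  set W' : T.Opens := W ⊓ h ⁻¹ᵁ V with hW'
  have e : W' ≤ h ⁻¹ᵁ V := inf_le_right
  have hWgen := (hW.mono (inf_le_left : W' ≤ W)).isGenerator (inf_le_left.trans hW.le)
  obtain ⟨d, hd⟩ := hWgen.dvd x' hx'
  have h1 : pull (h ≫ π) (inf_le_left.trans hW.le) x =
      pull (h ≫ π) (inf_le_left.trans hW.le) x' * pull h e c := by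
    have := congrArg (pull h e) hc
    rwa [map_mul, pull_pull, pull_pull] at this
  have hunit : IsUnit (pull h e c) := by
    refine IsUnit.of_mul_eq_one d (hWgen.cancel 1 ?_)
    rw [pow_one, mul_one]
    conv_rhs => rw [h1, hd]
    ring
  have htc : h t ∈ Y.basicOpen c := by
    have h2 : t ∈ T.basicOpen (pull h e c) := by
      rw [T.basicOpen_of_isUnit hunit]
      exact ⟨ht, htV⟩
    rw [pull, Scheme.basicOpen_appLE] at h2
    exact h2.2
  refine IsGeneratorOn.le_generatorLocus (W := Y.basicOpen c) ?_ htc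
  have hle := Y.basicOpen_le c
  refine IsGeneratorOn.of_isAffineOpen (hV.basicOpen c) (hle.trans hgen.le) ?_
  have hunit' : IsUnit (res hle c) := RingedSpace.isUnit_res_basicOpen _ c
  refine ⟨?_, fun a ha => ?_⟩
  · rw [← res_pull π hgen.le hle, hc, map_mul]
    exact mul_mem (res_basicOpen_mem_nonZeroDivisors hV c hgen'.1) hunit'.mem_nonZeroDivisors
  · obtain ⟨b, hb⟩ := hgen'.dvd a ha
    rw [← res_pull π hgen.le hle, ← res_pull π hgen.le hle, hc, hb, map_mul, map_mul]
    exact mul_dvd_mul_left _ hunit'.dvd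

theorem IsBlowup.hom_ext (hπ : IsBlowup π I) {h h' : T ⟶ Y}
    (hinv : IsInvertibleIdeal (I.comap (h ≫ π))) (heq : h ≫ π = h' ≫ π) : h = h' := by
  obtain ⟨f, -, hf⟩ := hπ.existsUnique_lift T _ hinv
  rw [hf h rfl, hf h' heq.symm]

/-- The charts of a blow-up are the spectra of the affine blow-up algebras. -/
theorem IsBlowup.chart (hπ : IsBlowup π I) (U : X.affineOpens) {x : Γ(X, U.1)}
    (hx : x ∈ I.ideal U) : IsAffineOpen (generatorLocus π (I.ideal U) x) ∧
      ∀ e : generatorLocus π (I.ideal U) x ≤ π ⁻¹ᵁ U.1,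
        IsBlowupAlgebra (pull π e) (I.ideal U) x := by
  obtain ⟨D, _, φ, hφ⟩ := IsBlowupAlgebra.exists_isBlowupAlgebra (I.ideal U) hx
  set V := generatorLocus π (I.ideal U) x with hVdef
  have hV : IsGeneratorOn π (I.ideal U) x V := isGeneratorOn_generatorLocus _ _ _
  let S : Scheme.{u} := Spec (CommRingCat.of D)
  let α : D ≃+* Γ(S, ⊤) := (Scheme.ΓSpecIso (CommRingCat.of D)).symm.commRingCatIsoToRingEquiv
  set ψ : Γ(X, U.1) →+* Γ(S, ⊤) := (α : D →+* Γ(S, ⊤)).comp φ with hψdef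
  have hψ : IsBlowupAlgebra ψ (I.ideal U) x := hφ.bijective_comp α
  obtain ⟨g, eg, hg⟩ := exists_hom_of_ringHom U.2 ψ
  have hgen : IsGeneratorOn g (I.ideal U) x ⊤ :=
    IsGeneratorOn.of_isAffineOpen (isAffineOpen_top S) eg (by rw [hg]; exact hψ.1)
  -- The universal property of `Y` gives `Spec D → V`; that of `D` gives `V → Spec D`. Each
  -- composite is the identity by the uniqueness part of one of the two properties.
  obtain ⟨h, hhg : h ≫ π = g, -⟩ := hπ.existsUnique_lift S g
    (isInvertibleIdeal_of fun t => ⟨U, x, ⊤, hx, Opens.mem_top t, hgen⟩)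
  have eh : ⊤ ≤ h ⁻¹ᵁ V :=
    le_preimage_generatorLocus hπ.isInvertibleIdeal h hx (by rwa [hhg])
  have hcomp : (pull h eh).comp (pull π hV.le) = ψ := by
    ext a
    rw [RingHom.comp_apply, pull_pull, ← hg]
    exact pull_congr hhg _ _ a
  obtain ⟨f, hf⟩ := hψ.exists_lift hx (hV.isGenerator hV.le)
  have eι : ⊤ ≤ V.ι ⁻¹ᵁ V := V.ι_preimage_self.ge
  obtain ⟨r, er, hr⟩ := exists_hom_of_ringHom (T := V) (isAffineOpen_top S) ((pull V.ι eι).comp f)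
  let h' : S ⟶ V := IsOpenImmersion.lift V.ι h (by
    rw [Scheme.Opens.range_ι]
    rintro _ ⟨t, rfl⟩
    exact eh (Opens.mem_top t))
  have hh' : h' ≫ V.ι = h := IsOpenImmersion.lift_fac _ _ _
  have hrg : r ≫ g = V.ι ≫ π := by
    refine hom_eq_of_pull_eq U.2 (fun t _ => eg (Opens.mem_top _)) (fun t _ => hV.le t.2) ?_
    ext a
    rw [← pull_pull r g eg er, hg, hr, ← pull_pull V.ι π hV.le eι, RingHom.comp_apply,
      ← RingHom.comp_apply f, hf]
  have h1 : r ≫ h' = 𝟙 _ := by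
    rw [← cancel_mono V.ι, Category.assoc, hh', Category.id_comp]
    refine (hπ.hom_ext (hπ.isInvertibleIdeal.comp V.ι) ?_).symm
    rw [Category.assoc, hhg, hrg]
  have h2 : h' ≫ r = 𝟙 _ := by
    refine hom_eq_of_pull_eq (isAffineOpen_top S) le_top le_top ?_
    have h3 : (pull (h' ≫ r) (U := ⊤) (V := ⊤) le_top).comp ψ = ψ := by
      ext a
      have e' : (⊤ : S.Opens) ≤ h' ⁻¹ᵁ ⊤ := le_top
      rw [RingHom.comp_apply, ← pull_pull h' r er e', hr, RingHom.comp_apply,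
        ← RingHom.comp_apply f, hf, pull_pull, ← hcomp, RingHom.comp_apply]
      exact pull_congr hh' _ _ _
    refine hψ.hom_ext (by rw [h3]; exact hψ.1) ?_
    rw [h3]
    ext a
    exact ((pull_id _ le_rfl _).trans (res_self _ _)).symm
  have : IsIso h' := ⟨r, h2, h1⟩
  have : IsIso r := ⟨h', h1, h2⟩
  have hbij : Function.Bijective (pull h eh) := by
    have e' : (⊤ : S.Opens) ≤ h' ⁻¹ᵁ ⊤ := le_top
    have h4 : pull h eh = (pull h' e').comp (pull V.ι eι) := by
      ext a
      rw [RingHom.comp_apply, pull_pull]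
      exact pull_congr hh'.symm _ _ _
    have h5 : Function.Bijective (pull h' e') := by
      rw [← appTop_eq_pull h']
      have : IsIso h'.appTop := inferInstanceAs (IsIso (h'.app ⊤))
      exact ConcreteCategory.bijective_of_isIso _
    rw [h4]
    exact h5.comp (pull_ι_bijective V)
  refine ⟨IsAffine.of_isIso r, fun e => ?_⟩
  refine IsBlowupAlgebra.of_bijective_comp hbij ?_
  rw [hcomp]
  exact hψ

/-- A morphism with the expected charts is a blow-up. -/
theorem isBlowup_of_charts (hinv : IsInvertibleIdeal (I.comap π))
    (hch : ∀ (U : X.affineOpens) (x : Γ(X, U.1)), x ∈ I.ideal U →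
      IsAffineOpen (generatorLocus π (I.ideal U) x) ∧
      ∀ e : generatorLocus π (I.ideal U) x ≤ π ⁻¹ᵁ U.1,
        IsBlowupAlgebra (pull π e) (I.ideal U) x) : IsBlowup π I := by
  have uniq : ∀ {T : Scheme.{u}} (h h' : T ⟶ Y), IsInvertibleIdeal (I.comap (h ≫ π)) →
      h ≫ π = h' ≫ π → h = h' := by
    intro T h h' hT heq
    refine Scheme.hom_ext_of_forall _ _ fun t => ?_
    obtain ⟨U, hU, htU, -⟩ := exists_isAffineOpen_le (Opens.mem_top ((h ≫ π) t))
    obtain ⟨x, hx, W, -, htW, hgen⟩ := exists_isGeneratorOn hT t ⟨U, hU⟩ htU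
    refine ⟨W, htW, ?_⟩
    obtain ⟨hV, hV'⟩ := hch ⟨U, hU⟩ x hx
    have hle := (isGeneratorOn_generatorLocus π (I.ideal ⟨U, hU⟩) x).le
    have e := le_preimage_generatorLocus hinv h hx hgen
    have e' := le_preimage_generatorLocus hinv h' hx (heq ▸ hgen)
    have hc : (pull h e).comp (pull π hle) = pull (h ≫ π) hgen.le := by
      ext a; rw [RingHom.comp_apply, pull_pull]
    have hc' : (pull h' e').comp (pull π hle) = pull (h ≫ π) hgen.le := by
      ext a; rw [RingHom.comp_apply, pull_pull]; exact pull_congr heq.symm _ _ _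
    refine ι_comp_eq_of_pull_eq hV e e' ((hV' hle).hom_ext ?_ (hc.trans hc'.symm))
    rw [hc]
    exact hgen.isGenerator hgen.le
  refine ⟨hinv, fun T g hg => ?_⟩
  suffices ∃ h : T ⟶ Y, h ≫ π = g by
    obtain ⟨h, rfl⟩ := this
    exact ⟨h, rfl, fun h' hh' => (uniq h h' hg hh'.symm).symm⟩
  have hloc : ∀ t : T, ∃ (W : T.Opens) (h : W.toScheme ⟶ Y), t ∈ W ∧ h ≫ π = W.ι ≫ g := by
    intro t
    obtain ⟨U, hU, htU, -⟩ := exists_isAffineOpen_le (Opens.mem_top (g t))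
    obtain ⟨x, hx, W, -, htW, hgen⟩ := exists_isGeneratorOn hg t ⟨U, hU⟩ htU
    obtain ⟨hV, hV'⟩ := hch ⟨U, hU⟩ x hx
    have hle := (isGeneratorOn_generatorLocus π (I.ideal ⟨U, hU⟩) x).le
    obtain ⟨f, hf⟩ := (hV' hle).exists_lift hx (hgen.isGenerator hgen.le)
    have eι : ⊤ ≤ W.ι ⁻¹ᵁ W := W.ι_preimage_self.ge
    obtain ⟨h, eh, hh⟩ := exists_hom_of_ringHom (T := W) hV ((pull W.ι eι).comp f)
    refine ⟨W, h, htW, ?_⟩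
    refine hom_eq_of_pull_eq hU (fun s _ => hle (eh (Opens.mem_top s)))
      (fun s _ => hgen.le s.2) ?_
    ext a
    rw [← pull_pull h π hle eh, hh, ← pull_pull W.ι g hgen.le eι, ← hf]
    rfl
  choose W h htW hh using hloc
  let 𝒰 : T.OpenCover := T.openCoverOfIsOpenCover W (by
    rw [IsOpenCover, eq_top_iff]
    exact fun t _ => Opens.mem_iSup.mpr ⟨t, htW t⟩)
  -- Local lifts agree on overlaps by uniqueness, since `I` stays invertible on open subschemes.
  have hcompat : ∀ i j : T,
      pullback.fst (W i).ι (W j).ι ≫ h i = pullback.snd (W i).ι (W j).ι ≫ h j := by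
    intro i j
    refine uniq _ _ ?_ ?_
    · rw [Category.assoc, hh, ← Category.assoc]
      exact hg.comp (pullback.fst (W i).ι (W j).ι ≫ (W i).ι)
    · rw [Category.assoc, Category.assoc, hh, hh, pullback.condition_assoc]
  refine ⟨𝒰.glueMorphisms h hcompat, 𝒰.hom_ext _ _ fun i => ?_⟩
  rw [← Category.assoc]
  exact (congrArg (· ≫ π) (𝒰.ι_glueMorphisms h hcompat i)).trans (hh i)

end Charts


/-! ### Witt vectors of length two over a perfect field -/

section Witt

variable (p : ℕ) [Fact p.Prime] {k : Type u} [Field k] [CharP k p]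

theorem coeff_zero_natCast_mul (z : W₂ p k) : ((p : W₂ p k) * z).coeff 0 = 0 := by
  obtain ⟨z, rfl⟩ := WittVector.truncate_surjective p 2 k z
  rw [← map_natCast (WittVector.truncate 2), ← map_mul, WittVector.coeff_truncate, mul_comm]
  exact WittVector.mul_charP_coeff_zero z

theorem coeff_one_natCast_mul (z : W₂ p k) : ((p : W₂ p k) * z).coeff 1 = z.coeff 0 ^ p := by
  obtain ⟨z, rfl⟩ := WittVector.truncate_surjective p 2 k z
  rw [← map_natCast (WittVector.truncate 2), ← map_mul, WittVector.coeff_truncate, mul_comm]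
  exact WittVector.mul_charP_coeff_succ z 0

/-- Over a perfect field, `W₂(k)` is a flat lifting of `k`. -/
theorem isDeformation_residue [PerfectRing k p] : IsDeformation p (residue p k) := by
  have hp := (Fact.out : p.Prime).ne_zero
  refine ⟨fun a => ⟨TruncatedWittVector.mk p fun _ => a,
    TruncatedWittVector.coeff_mk (p := p) (fun _ => a) (0 : Fin 2)⟩,
    CharP.cast_eq_zero k p, fun a ha => ?_, fun a ha => ?_, ?_⟩
  · obtain ⟨b, hb⟩ := (PerfectRing.bijective_frobenius (R := k) (p := p)).2 (a.coeff 1)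
    refine ⟨TruncatedWittVector.mk p fun _ => b, TruncatedWittVector.ext fun i => ?_⟩
    fin_cases i
    · exact (show a.coeff 0 = 0 from ha).trans (coeff_zero_natCast_mul p _).symm
    · refine (Eq.trans ?_ (coeff_one_natCast_mul p _).symm)
      rw [TruncatedWittVector.coeff_mk]
      exact hb.symm
  · have h := coeff_one_natCast_mul p a
    rw [ha, TruncatedWittVector.coeff_zero] at h
    exact pow_eq_zero_iff hp |>.mp h.symm
  · refine TruncatedWittVector.ext fun i => ?_
    rw [TruncatedWittVector.coeff_zero]
    fin_cases i
    · exact coeff_zero_natCast_mul p _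
    · refine (coeff_one_natCast_mul p _).trans ?_
      have := coeff_zero_natCast_mul p (1 : W₂ p k)
      rw [mul_one] at this
      rw [this, zero_pow hp]

end Witt

/-- The one-term equational criterion for flatness. With `r = p` it carries the description of the
annihilator of `p` from the base to a flat algebra. -/
theorem exists_sum_smul_of_smul_eq_zero {R M : Type*} [CommRing R] [AddCommGroup M] [Module R M]
    [Module.Flat R M] (r : R) (m : M) (h : r • m = 0) :
    ∃ (n : ℕ) (c : Fin n → R) (y : Fin n → M), m = ∑ j, c j • y j ∧ ∀ j, r * c j = 0 := by
  have hrel : ∑ i : Fin 1, (fun _ : Fin 1 => r) i • (fun _ : Fin 1 => m) i = 0 := by simpa using h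
  obtain ⟨n, c, y, hy, hc⟩ := Module.Flat.isTrivialRelation_of_sum_smul_eq_zero hrel
  exact ⟨n, c 0, y, hy 0, fun j => by simpa using hc j⟩

/-- Base change of a flat lifting along a flat ring map. -/
theorem IsDeformation.of_flat {p : ℕ} {R R₀ A A₀ : Type u} [CommRing R] [CommRing R₀] [CommRing A]
    [CommRing A₀] {r : R →+* R₀} (hr : IsDeformation p r) {f : R →+* A} (hf : f.Flat)
    {s : A →+* A₀} (hs : Function.Surjective s)
    (hker : RingHom.ker s = (RingHom.ker r).map f) : IsDeformation p s := by
  have hkr : RingHom.ker r = Ideal.span {(p : R)} := by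
    ext a
    rw [RingHom.mem_ker, Ideal.mem_span_singleton]
    constructor
    · exact fun h => hr.exists_eq_mul a h
    · rintro ⟨b, rfl⟩
      exact hr.map_natCast_mul b
  have hks : ∀ a, s a = 0 ↔ (p : A) ∣ a := by
    intro a
    rw [← RingHom.mem_ker, hker, hkr, Ideal.map_span, Set.image_singleton, map_natCast,
      Ideal.mem_span_singleton]
  refine ⟨hs, ?_, fun a ha => (hks a).mp ha, fun a ha => (hks a).mpr ?_, ?_⟩
  · rw [← map_natCast s, hks]
  · let := f.toAlgebra
    have : Module.Flat R A := hf
    obtain ⟨n, c, y, rfl, hc⟩ := exists_sum_smul_of_smul_eq_zero (p : R) a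
      (by rw [Algebra.smul_def, map_natCast, ha])
    refine Finset.dvd_sum fun j _ => ?_
    obtain ⟨b, hb⟩ := hr.exists_eq_mul _ (hr.eq_zero_of_mul _ (hc j))
    rw [hb, Algebra.smul_def, map_mul, map_natCast, mul_assoc]
    exact dvd_mul_right _ _
  · rw [← map_natCast f, ← map_mul, hr.sq_eq_zero, map_zero]

theorem IsDeformation.of_equiv {p : ℕ} {R R' S S' : Type u} [CommRing R] [CommRing R']
    [CommRing S] [CommRing S'] {r : R →+* S} (hr : IsDeformation p r) (e : R' ≃+* R) (e' : S' ≃+* S)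
    {r' : R' →+* S'} (h : ∀ a, e' (r' a) = r (e a)) : IsDeformation p r' := by
  have h0 : ∀ a, r' a = 0 ↔ r (e a) = 0 := fun a => by
    rw [← h, map_eq_zero_iff e' e'.injective]
  refine ⟨fun a => ?_, ?_, fun a ha => ?_, fun a ha => ?_, ?_⟩
  · obtain ⟨b, hb⟩ := hr.surjective (e' a)
    exact ⟨e.symm b, e'.injective (by rw [h, e.apply_symm_apply, hb])⟩
  · exact e'.injective (by rw [map_natCast, hr.natCast_eq_zero, map_zero])
  · obtain ⟨b, hb⟩ := hr.exists_eq_mul _ ((h0 a).mp ha)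
    exact ⟨e.symm b, e.injective (by rw [hb, map_mul, map_natCast, e.apply_symm_apply])⟩
  · exact (h0 a).mpr (hr.eq_zero_of_mul _ (by rw [← map_natCast e, ← map_mul, ha, map_zero]))
  · exact e.injective (by rw [map_mul, map_natCast, hr.sq_eq_zero, map_zero])

/-! ### Thickenings -/

/-- `i : X ⟶ X₂` exhibits `X₂` as a flat lifting modulo `p ^ 2` of `X`. -/
structure IsThickening (p : ℕ) {X X₂ : Scheme.{u}} (i : X ⟶ X₂) : Prop where
  isClosedImmersion : IsClosedImmersion i
  surjective : Function.Surjective i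
  isDeformation : ∀ U : X₂.Opens, IsAffineOpen U →
    IsDeformation p (pull i (le_refl (i ⁻¹ᵁ U)))

section Lifting

variable {p : ℕ} [Fact p.Prime] {k : Type u} [Field k] [CharP k p] [PerfectRing k p]

theorem isClosedImmersion_specResidue : IsClosedImmersion (specResidue p k) :=
  IsClosedImmersion.spec_of_surjective _ (isDeformation_residue p).surjective

theorem surjective_specResidue : Surjective (specResidue p k) := by
  refine ⟨?_⟩
  have h := (isDeformation_residue p (k := k))
  rw [← Set.range_eq_univ]
  refine (_root_.range_comap_of_surjective _ (residue p k) h.surjective).trans ?_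
  refine Set.eq_univ_iff_forall.mpr ?_
  intro q a ha
  obtain ⟨b, rfl⟩ := h.exists_eq_mul a ha
  refine Ideal.mul_mem_right _ _ (q.2.mem_of_pow_mem 2 ?_)
  rw [pow_two, h.sq_eq_zero]
  exact zero_mem _

theorem isDeformation_specResidue :
    IsDeformation p (pull (specResidue p k) (U := ⊤) (V := ⊤) le_top) := by
  refine (isDeformation_residue p (k := k)).of_equiv
    (Scheme.ΓSpecIso (CommRingCat.of (W₂ p k))).commRingCatIsoToRingEquiv
    (Scheme.ΓSpecIso (CommRingCat.of k)).commRingCatIsoToRingEquiv fun a => ?_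
  have := Scheme.ΓSpecIso_naturality (CommRingCat.ofHom (residue p k))
  have h2 : (pull (specResidue p k) (U := ⊤) (V := ⊤) le_top) = (specResidue p k).appTop.hom :=
    (appTop_eq_pull _).symm
  rw [h2]
  exact congr($(this).hom a)

/-- All properties are base changed from `Spec k → Spec W₂(k)`. Beyond this point only these
properties of the lifting are used, not the Witt vectors. -/
theorem IsLifting.isThickening {X X₂ : Scheme.{u}} {s : X ⟶ Spec (CommRingCat.of k)}
    {s₂ : X₂ ⟶ Spec (CommRingCat.of (W₂ p k))} {i : X ⟶ X₂} (h : IsLifting p s s₂ i) :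
    IsThickening p i := by
  have h1 := isClosedImmersion_specResidue (p := p) (k := k)
  have h2 := surjective_specResidue (p := p) (k := k)
  have h3 : IsClosedImmersion i :=
    MorphismProperty.of_isPullback (P := @IsClosedImmersion) h.isPullback.flip h1
  have h4 : Surjective i := MorphismProperty.of_isPullback (P := @Surjective) h.isPullback.flip h2
  refine ⟨h3, h4.surj, fun U hU => ?_⟩
  have := h.flat
  have e : U ≤ s₂ ⁻¹ᵁ ⊤ := le_top
  have hker : i.ker = (specResidue p k).ker.comap s₂ := by
    rw [← Scheme.IdealSheafData.ker_fst_of_isClosedImmersion, ← h.isPullback.isoPullback_hom_fst,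
      Scheme.Hom.ker_comp_of_isIso]
  have hker' := congrArg (fun K => K.ideal ⟨U, hU⟩) hker
  dsimp only at hker'
  rw [ideal_comap _ s₂ ⟨⊤, isAffineOpen_top _⟩ ⟨U, hU⟩ e, Scheme.Hom.ker_apply,
    Scheme.Hom.ker_apply] at hker'
  refine (isDeformation_specResidue (p := p) (k := k)).of_flat
    (s₂.flat_appLE (isAffineOpen_top _) hU e) ?_ ?_
  · have := i.app_surjective U hU
    rwa [Scheme.Hom.app_eq_appLE] at this
  · rw [Scheme.Hom.app_eq_appLE, Scheme.Hom.app_eq_appLE] at hker'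
    exact hker'

end Lifting

namespace IsThickening

variable {p : ℕ} {X X₂ : Scheme.{u}} {i : X ⟶ X₂}

theorem isAffineOpen (hi : IsThickening p i) {U : X₂.Opens} (hU : IsAffineOpen U) :
    IsAffineOpen (i ⁻¹ᵁ U) :=
  have := hi.isClosedImmersion
  hU.preimage i

theorem le_of_preimage_le (hi : IsThickening p i) {U V : X₂.Opens} (h : i ⁻¹ᵁ U ≤ i ⁻¹ᵁ V) :
    U ≤ V := by
  intro t ht
  obtain ⟨s, rfl⟩ := hi.surjective t
  exact h ht

theorem exists_preimage_eq (hi : IsThickening p i) (V : X.Opens) :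
    ∃ V₂ : X₂.Opens, i ⁻¹ᵁ V₂ = V := by
  have := hi.isClosedImmersion
  obtain ⟨s, hs, hs'⟩ := i.isClosedEmbedding.isInducing.isOpen_iff.mp V.isOpen
  exact ⟨⟨s, hs⟩, Opens.ext hs'⟩

/-- An open subset of a thickening is affine if its reduction is affine and sections lift. -/
theorem isAffineOpen_of_surjective (hi : IsThickening p i) {V : X₂.Opens}
    (hV : IsAffineOpen (i ⁻¹ᵁ V)) (hsurj : Function.Surjective (pull i (le_refl (i ⁻¹ᵁ V)))) :
    IsAffineOpen V := by
  set ρ := pull i (le_refl (i ⁻¹ᵁ V)) with hρ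
  have hbasic : ∀ g : Γ(X₂, V), i ⁻¹ᵁ X₂.basicOpen g = X.basicOpen (ρ g) := by
    intro g
    rw [hρ, pull, Scheme.Hom.appLE_eq_app, Scheme.preimage_basicOpen]
  let S : Set Γ(X₂, V) := {g | IsAffineOpen (X₂.basicOpen g)}
  refine isAffineOpen_of_isAffineOpen_basicOpen V S ?_ fun g hg => hg
  have hcov : i ⁻¹ᵁ V ≤ ⨆ g : ρ '' S, X.basicOpen g.1 := by
    intro t ht
    obtain ⟨W, hW, htW, hle⟩ := exists_isAffineOpen_le (show i t ∈ V from ht)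
    obtain ⟨g₀, hg₀, htg⟩ := hV.exists_basicOpen_le (V := i ⁻¹ᵁ W) ⟨t, htW⟩ ht
    obtain ⟨g, rfl⟩ := hsurj g₀
    rw [← hbasic] at hg₀
    have h1 : X₂.basicOpen g ≤ W := hi.le_of_preimage_le hg₀
    have h2 : X₂.basicOpen (res hle g) = X₂.basicOpen g := by
      rw [res, Scheme.basicOpen_res]
      exact inf_eq_right.mpr h1
    refine Opens.mem_iSup.mpr ⟨⟨ρ g, g, ?_, rfl⟩, htg⟩
    change IsAffineOpen (X₂.basicOpen g)
    rw [← h2]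
    exact hW.basicOpen _
  have hspan := (hV.self_le_iSup_basicOpen_iff).mp hcov
  rw [← Ideal.map_span] at hspan
  -- An element of the span which reduces to `1` is nowhere zero on `V`, because the thickening has
  -- the same points; hence it is a unit.
  obtain ⟨z, hz, hz1⟩ := (Ideal.mem_map_iff_of_surjective ρ hsurj).mp
    (hspan.ge (Submodule.mem_top (x := 1)))
  refine Ideal.eq_top_of_isUnit_mem _ hz ?_
  have hle : V ≤ X₂.basicOpen z := by
    refine hi.le_of_preimage_le ?_
    rw [hbasic, hz1, X.basicOpen_of_isUnit isUnit_one]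
  have h3 := (RingedSpace.isUnit_res_basicOpen X₂.toRingedSpace z).map (res hle)
  have h4 : res hle (res (X₂.basicOpen_le z) z) = z := by rw [res_res, res_self]
  exact h4 ▸ h3

end IsThickening


/-! ### Liftings of closed subschemes -/

/-- The ideal sheaf `J` on a thickening of `X` defines a flat lifting of the closed subscheme
defined by `I`. -/
structure LiftsIdeal {p : ℕ} {X X₂ : Scheme.{u}} {i : X ⟶ X₂} (hi : IsThickening p i)
    (I : X.IdealSheafData) (J : X₂.IdealSheafData) : Prop where
  map_eq : ∀ (U : X₂.Opens) (hU : IsAffineOpen U),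
    (J.ideal ⟨U, hU⟩).map (pull i (le_refl (i ⁻¹ᵁ U))) =
      I.ideal ⟨i ⁻¹ᵁ U, hi.isAffineOpen hU⟩
  exists_eq_mul : ∀ (U : X₂.Opens) (hU : IsAffineOpen U) (z : Γ(X₂, U)),
    (p : Γ(X₂, U)) * z ∈ J.ideal ⟨U, hU⟩ →
      ∃ l ∈ J.ideal ⟨U, hU⟩, (p : Γ(X₂, U)) * z = p * l

namespace IsDeformation

variable {p : ℕ} {A A₀ C C₀ : Type*} [CommRing A] [CommRing A₀] [CommRing C] [CommRing C₀]
  {r : A →+* A₀} {rC : C →+* C₀} {f : A →+* C} {f₀ : A₀ →+* C₀}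

/-- Flatness of `C` turns `p f(z) = 0` into `f(z) = p f(b)`. Replacing `z` by `z - p b` moves it
into the kernel without changing `p z`. -/
theorem exists_eq_mul_of_mem_ker (hr : IsDeformation p r) (hC : IsDeformation p rC)
    (hf : Function.Surjective f) {z : A} (hz : (p : A) * z ∈ RingHom.ker f) :
    ∃ l ∈ RingHom.ker f, (p : A) * z = p * l := by
  rw [RingHom.mem_ker, map_mul, map_natCast] at hz
  obtain ⟨c, hc⟩ := hC.exists_eq_mul _ (hC.eq_zero_of_mul _ hz)
  obtain ⟨b, rfl⟩ := hf c
  refine ⟨z - p * b, by rw [RingHom.mem_ker, map_sub, map_mul, map_natCast, hc, sub_self], ?_⟩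
  linear_combination b * hr.sq_eq_zero

theorem map_ker_eq (hr : IsDeformation p r) (hC : IsDeformation p rC)
    (hf : Function.Surjective f) (comm : f₀.comp r = rC.comp f) :
    (RingHom.ker f).map r = RingHom.ker f₀ := by
  have hc : ∀ a, f₀ (r a) = rC (f a) := fun a => RingHom.congr_fun comm a
  refine le_antisymm (Ideal.map_le_iff_le_comap.mpr fun a ha => ?_) fun a₀ ha => ?_
  · rw [Ideal.mem_comap, RingHom.mem_ker, hc, ha, map_zero]
  · obtain ⟨a, rfl⟩ := hr.surjective a₀
    rw [RingHom.mem_ker, hc] at ha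
    obtain ⟨c, hc⟩ := hC.exists_eq_mul _ ha
    obtain ⟨b, rfl⟩ := hf c
    have : r a = r (a - p * b) := by rw [map_sub, hr.map_natCast_mul, sub_zero]
    rw [this]
    exact Ideal.mem_map_of_mem r
      (by rw [RingHom.mem_ker, map_sub, map_mul, map_natCast, hc, sub_self])

end IsDeformation

theorem ker_pull {X Z : Scheme.{u}} (j : Z ⟶ X) [IsClosedImmersion j] {U : X.Opens}
    (hU : IsAffineOpen U) {W : Z.Opens} (hW : W = j ⁻¹ᵁ U) :
    j.ker.ideal ⟨U, hU⟩ = RingHom.ker (pull j hW.le) := by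
  subst hW
  rw [Scheme.Hom.ker_apply, Scheme.Hom.app_eq_appLE]

theorem pull_comm {X X₂ Z Z₂ : Scheme.{u}} {iX : X ⟶ X₂} {iZ : Z ⟶ Z₂} {j : Z ⟶ X} {j₂ : Z₂ ⟶ X₂}
    (h : iZ ≫ j₂ = j ≫ iX) {U₂ : X₂.Opens} {U : X.Opens} {W₂ : Z₂.Opens} {W : Z.Opens}
    (e₁ : U ≤ iX ⁻¹ᵁ U₂) (e₂ : W₂ ≤ j₂ ⁻¹ᵁ U₂) (e₃ : W ≤ j ⁻¹ᵁ U) (e₄ : W ≤ iZ ⁻¹ᵁ W₂) :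
    (pull j e₃).comp (pull iX e₁) = (pull iZ e₄).comp (pull j₂ e₂) := by
  ext a
  rw [RingHom.comp_apply, RingHom.comp_apply, pull_pull, pull_pull]
  exact pull_congr h.symm _ _ _

theorem preimage_comm {X X₂ Z Z₂ : Scheme.{u}} {iX : X ⟶ X₂} {iZ : Z ⟶ Z₂} {j : Z ⟶ X}
    {j₂ : Z₂ ⟶ X₂} (h : iZ ≫ j₂ = j ≫ iX) (U₂ : X₂.Opens) :
    iZ ⁻¹ᵁ j₂ ⁻¹ᵁ U₂ = j ⁻¹ᵁ iX ⁻¹ᵁ U₂ := by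
  rw [← Scheme.Hom.comp_preimage, h, Scheme.Hom.comp_preimage]

theorem liftsIdeal_ker {p : ℕ} {X X₂ Z Z₂ : Scheme.{u}} {iX : X ⟶ X₂} {iZ : Z ⟶ Z₂} {j : Z ⟶ X}
    {j₂ : Z₂ ⟶ X₂} (hX : IsThickening p iX) (hZ : IsThickening p iZ) [IsClosedImmersion j]
    [IsClosedImmersion j₂] (h : iZ ≫ j₂ = j ≫ iX) : LiftsIdeal hX j.ker j₂.ker := by
  have hsurj : ∀ U₂ : X₂.Opens, IsAffineOpen U₂ →
      Function.Surjective (pull j₂ (le_refl (j₂ ⁻¹ᵁ U₂))) := by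
    intro U₂ hU
    have := j₂.app_surjective U₂ hU
    rwa [Scheme.Hom.app_eq_appLE] at this
  refine ⟨fun U₂ hU => ?_, fun U₂ hU z hz => ?_⟩
  · rw [ker_pull j (hX.isAffineOpen hU) (preimage_comm h U₂), ker_pull j₂ hU rfl]
    exact (hX.isDeformation U₂ hU).map_ker_eq (hZ.isDeformation _ (hU.preimage j₂)) (hsurj U₂ hU)
      (pull_comm h _ _ _ _)
  · rw [ker_pull j₂ hU rfl] at hz ⊢
    exact (hX.isDeformation U₂ hU).exists_eq_mul_of_mem_ker
      (hZ.isDeformation _ (hU.preimage j₂)) (hsurj U₂ hU) hz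

/-! ### Lifting a blow-up -/

section LiftBlowup

variable {p : ℕ} {X X₂ Y Y₂ : Scheme.{u}} {iX : X ⟶ X₂} {iY : Y ⟶ Y₂} {π : Y ⟶ X} {π₂ : Y₂ ⟶ X₂}
  {hX : IsThickening p iX} {hY : IsThickening p iY} {I : X.IdealSheafData}
  {J : X₂.IdealSheafData} {L : Y₂.IdealSheafData}

theorem isGeneratorOn_of_isGeneratorOn_preimage (hπ : iY ≫ π₂ = π ≫ iX)
    (hL : LiftsIdeal hY (I.comap π) L) (hJL : J.comap π₂ ≤ L) {U : X₂.Opens}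
    (hU : IsAffineOpen U) {x : Γ(X₂, U)} (hx : x ∈ J.ideal ⟨U, hU⟩) {W : Y₂.Opens}
    (hW : IsAffineOpen W) (hgen : IsGeneratorOn π (I.ideal ⟨iX ⁻¹ᵁ U, hX.isAffineOpen hU⟩)
      (pull iX (le_refl (iX ⁻¹ᵁ U)) x) (iY ⁻¹ᵁ W)) :
    IsGeneratorOn π₂ (J.ideal ⟨U, hU⟩) x W ∧ L.ideal ⟨W, hW⟩ = (J.comap π₂).ideal ⟨W, hW⟩ := by
  have e : W ≤ π₂ ⁻¹ᵁ U := hY.le_of_preimage_le (hgen.le.trans (preimage_comm hπ U).ge)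
  have h1 := ideal_comap J π₂ ⟨U, hU⟩ ⟨W, hW⟩ e
  have h2 := ideal_comap I π ⟨_, hX.isAffineOpen hU⟩ ⟨_, hY.isAffineOpen hW⟩ hgen.le
  obtain ⟨h3, h4⟩ := (hY.isDeformation W hW).isGenerator_of
    (pull_comm hπ (le_refl (iX ⁻¹ᵁ U)) e hgen.le le_rfl) (J := J.ideal ⟨U, hU⟩)
    (I := I.ideal ⟨_, hX.isAffineOpen hU⟩) (L := L.ideal ⟨W, hW⟩) (h1.ge.trans (hJL _))
    (hL.exists_eq_mul W hW) ((hL.map_eq W hW).trans h2) hx (hgen.isGenerator _)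
  exact ⟨IsGeneratorOn.of_isAffineOpen hW e h3, h4.trans h1.symm⟩

/-- The charts upstairs and downstairs have the same points: being a generator passes to the
reduction, and lifts from it by flatness of `L`. -/
theorem preimage_generatorLocus (hπ : iY ≫ π₂ = π ≫ iX) (hJ : LiftsIdeal hX I J)
    (hL : LiftsIdeal hY (I.comap π) L) (hJL : J.comap π₂ ≤ L) {U : X₂.Opens}
    (hU : IsAffineOpen U) {x : Γ(X₂, U)} (hx : x ∈ J.ideal ⟨U, hU⟩) :
    iY ⁻¹ᵁ generatorLocus π₂ (J.ideal ⟨U, hU⟩) x =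
      generatorLocus π (I.ideal ⟨iX ⁻¹ᵁ U, hX.isAffineOpen hU⟩)
        (pull iX (le_refl (iX ⁻¹ᵁ U)) x) := by
  apply le_antisymm
  · intro t ht
    obtain ⟨W, hW, htW, hle⟩ := exists_isAffineOpen_le
      (show iY t ∈ generatorLocus π₂ (J.ideal ⟨U, hU⟩) x from ht)
    have hgen := (isGeneratorOn_generatorLocus π₂ (J.ideal ⟨U, hU⟩) x).mono hle
    have e : iY ⁻¹ᵁ W ≤ π ⁻¹ᵁ iX ⁻¹ᵁ U := by
      rw [← preimage_comm hπ]
      exact fun s hs => hgen.le hs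
    refine IsGeneratorOn.le_generatorLocus (W := iY ⁻¹ᵁ W) ?_ htW
    refine IsGeneratorOn.of_isAffineOpen (hY.isAffineOpen hW) e ?_
    rw [← hJ.map_eq U hU]
    exact (hY.isDeformation W hW).isGenerator_reduction (pull_comm hπ _ _ _ _)
      (hX.isDeformation U hU).surjective (hgen.isGenerator hgen.le)
  · obtain ⟨V, hV⟩ := hY.exists_preimage_eq (generatorLocus π
      (I.ideal ⟨iX ⁻¹ᵁ U, hX.isAffineOpen hU⟩) (pull iX (le_refl (iX ⁻¹ᵁ U)) x))
    intro t ht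
    rw [← hV] at ht
    obtain ⟨W, hW, htW, hle⟩ := exists_isAffineOpen_le (show iY t ∈ V from ht)
    refine IsGeneratorOn.le_generatorLocus
      (isGeneratorOn_of_isGeneratorOn_preimage (hX := hX) hπ hL hJL hU hx hW ?_).1 htW
    refine (isGeneratorOn_generatorLocus _ _ _).mono ?_
    rw [← hV]
    exact fun s hs => hle hs

theorem exists_isGeneratorOn_thickening (hπ : iY ≫ π₂ = π ≫ iX) (hJ : LiftsIdeal hX I J)
    (hL : LiftsIdeal hY (I.comap π) L) (hJL : J.comap π₂ ≤ L)
    (hinv : IsInvertibleIdeal (I.comap π)) (t : Y₂) {U : X₂.Opens} (hU : IsAffineOpen U)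
    (htU : π₂ t ∈ U) : ∃ x ∈ J.ideal ⟨U, hU⟩, ∃ (W : Y₂.Opens) (hW : IsAffineOpen W), t ∈ W ∧
      IsGeneratorOn π₂ (J.ideal ⟨U, hU⟩) x W ∧
      L.ideal ⟨W, hW⟩ = (J.comap π₂).ideal ⟨W, hW⟩ := by
  obtain ⟨s, rfl⟩ := hY.surjective t
  have hs : s ∈ iY ⁻¹ᵁ π₂ ⁻¹ᵁ U := htU
  rw [preimage_comm hπ] at hs
  obtain ⟨x₀, hx₀, W₀, -, hsW₀, hgen⟩ :=
    exists_isGeneratorOn hinv s ⟨_, hX.isAffineOpen hU⟩ hs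
  obtain ⟨W₁, rfl⟩ := hY.exists_preimage_eq W₀
  obtain ⟨W, hW, hsW, hle⟩ := exists_isAffineOpen_le (show iY s ∈ W₁ from hsW₀)
  rw [← hJ.map_eq U hU] at hx₀
  obtain ⟨x, hx, rfl⟩ :=
    (Ideal.mem_map_iff_of_surjective _ (hX.isDeformation U hU).surjective).mp hx₀
  exact ⟨x, hx, W, hW, hsW, isGeneratorOn_of_isGeneratorOn_preimage (hX := hX) hπ hL hJL hU hx hW
    (hgen.mono fun r hr => hle hr)⟩

theorem eq_comap_of_liftsIdeal (hπ : iY ≫ π₂ = π ≫ iX) (hJ : LiftsIdeal hX I J)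
    (hL : LiftsIdeal hY (I.comap π) L) (hJL : J.comap π₂ ≤ L)
    (hinv : IsInvertibleIdeal (I.comap π)) : L = J.comap π₂ := by
  have : ∀ t : Y₂, ∃ W : Y₂.affineOpens, t ∈ W.1 ∧ L.ideal W = (J.comap π₂).ideal W := by
    intro t
    obtain ⟨U, hU, htU, -⟩ := exists_isAffineOpen_le (Opens.mem_top (π₂ t))
    obtain ⟨-, -, W, hW, htW, -, h⟩ :=
      exists_isGeneratorOn_thickening hπ hJ hL hJL hinv t hU htU
    exact ⟨⟨W, hW⟩, htW, h⟩
  choose W hW hW' using this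
  refine Scheme.IdealSheafData.ext_of_iSup_eq_top W ?_ hW'
  exact eq_top_iff.mpr fun t _ => Opens.mem_iSup.mpr ⟨t, hW t⟩

theorem isInvertibleIdeal_comap_of_lift (hπ : iY ≫ π₂ = π ≫ iX) (hJ : LiftsIdeal hX I J)
    (hL : LiftsIdeal hY (I.comap π) L) (hJL : J.comap π₂ ≤ L)
    (hinv : IsInvertibleIdeal (I.comap π)) : IsInvertibleIdeal (J.comap π₂) := by
  refine isInvertibleIdeal_of fun t => ?_
  obtain ⟨U, hU, htU, -⟩ := exists_isAffineOpen_le (Opens.mem_top (π₂ t))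
  obtain ⟨x, hx, W, hW, htW, h, -⟩ :=
    exists_isGeneratorOn_thickening hπ hJ hL hJL hinv t hU htU
  exact ⟨⟨U, hU⟩, x, W, hx, htW, h⟩

/-- A flat lifting of a blow-up which lifts the exceptional divisor is a blow-up. -/
theorem isBlowup_of_lift (hπ : iY ≫ π₂ = π ≫ iX) (hJ : LiftsIdeal hX I J)
    (hL : LiftsIdeal hY (I.comap π) L) (hJL : J.comap π₂ ≤ L) (hbl : IsBlowup π I) :
    IsBlowup π₂ J := by
  refine isBlowup_of_charts
    (isInvertibleIdeal_comap_of_lift hπ hJ hL hJL hbl.isInvertibleIdeal) ?_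
  rintro ⟨U, hU⟩ x hx
  have hA := hX.isDeformation U hU
  have hx₀ : pull iX (le_refl (iX ⁻¹ᵁ U)) x ∈ I.ideal ⟨iX ⁻¹ᵁ U, hX.isAffineOpen hU⟩ := by
    rw [← hJ.map_eq U hU]
    exact Ideal.mem_map_of_mem _ hx
  obtain ⟨hV, hV'⟩ := hbl.chart ⟨_, hX.isAffineOpen hU⟩ hx₀
  have hpre := preimage_generatorLocus hπ hJ hL hJL hU hx
  have hgen := isGeneratorOn_generatorLocus π₂ (J.ideal ⟨U, hU⟩) x
  generalize hV₂ : generatorLocus π₂ (J.ideal ⟨U, hU⟩) x = V₂ at *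
  rw [← hpre] at hV
  have e₀ : iY ⁻¹ᵁ V₂ ≤ π ⁻¹ᵁ iX ⁻¹ᵁ U := by
    rw [← preimage_comm hπ]
    exact fun s hs => hgen.le hs
  have hb : IsBlowupAlgebra (pull π e₀) (I.ideal ⟨_, hX.isAffineOpen hU⟩)
      (pull iX (le_refl (iX ⁻¹ᵁ U)) x) := by
    clear hgen hV
    subst hV₂
    revert e₀
    rw [hpre]
    exact hV'
  rw [← hJ.map_eq U hU] at hb
  have hcomm := pull_comm hπ (le_refl (iX ⁻¹ᵁ U)) hgen.le e₀ (le_refl (iY ⁻¹ᵁ V₂))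
  -- Affineness of `V₂` is not yet known, so sections are lifted by hand. A section below is `b₀ /
  -- x^n`; lift `b₀` to `b ∈ J^n` and divide by `x^n`, which is possible because `x` generates on
  -- `V₂`.
  have hsurj : Function.Surjective (pull iY (le_refl (iY ⁻¹ᵁ V₂))) := by
    intro d₀
    obtain ⟨n, b₀, hb₀, h⟩ := hb.exists_pow_mul d₀
    obtain ⟨b, hb', rfl⟩ := IsDeformation.exists_mem_pow hA.surjective hb₀
    obtain ⟨d, hd⟩ := (hgen.isGenerator hgen.le).pow_dvd hb'
    refine ⟨d, hb.cancel n ?_⟩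
    have h1 : ∀ a, pull π e₀ (pull iX (le_refl (iX ⁻¹ᵁ U)) a) =
        pull iY (le_refl (iY ⁻¹ᵁ V₂)) (pull π₂ hgen.le a) := fun a => RingHom.congr_fun hcomm a
    rw [h, h1, h1, hd, map_mul, map_pow]
  have hV₂' : IsAffineOpen V₂ := hY.isAffineOpen_of_surjective hV hsurj
  exact ⟨hV₂', fun e => hA.isBlowupAlgebra (hY.isDeformation V₂ hV₂') hcomm hx
    (hgen.isGenerator e) hb⟩

end LiftBlowup


/-! ### Liftings of the Frobenius -/

section Frobenius

variable {p : ℕ} [Fact p.Prime] {k : Type u} [CommRing k] [CharP k p]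

theorem pull_absFrobenius {X : Scheme.{u}} (s : X ⟶ Spec (CommRingCat.of k)) {U V : X.Opens}
    (h : V ≤ U) (e : V ≤ absFrobenius p s ⁻¹ᵁ U) (a : Γ(X, U)) :
    pull (absFrobenius p s) e a = res h a ^ p :=
  map_pow (res h) a p

theorem absFrobenius_comp {X Y : Scheme.{u}} (s : X ⟶ Spec (CommRingCat.of k))
    (t : Y ⟶ Spec (CommRingCat.of k)) (f : Y ⟶ X) :
    absFrobenius p t ≫ f = f ≫ absFrobenius p s := by
  refine Scheme.hom_ext_of_forall _ _ fun y => ?_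
  obtain ⟨U, hU, hyU, -⟩ := exists_isAffineOpen_le (Opens.mem_top (f y))
  refine ⟨f ⁻¹ᵁ U, hyU, ?_⟩
  have e₁ : f ⁻¹ᵁ U ≤ absFrobenius p t ⁻¹ᵁ f ⁻¹ᵁ U := le_rfl
  have e₂ : U ≤ absFrobenius p s ⁻¹ᵁ U := le_rfl
  refine ι_comp_eq_of_pull_eq hU e₁ (le_refl (f ⁻¹ᵁ U)) ?_
  ext a
  rw [← pull_pull _ f le_rfl e₁, ← pull_pull f _ e₂ le_rfl, pull_absFrobenius t le_rfl,
    pull_absFrobenius s le_rfl, res_self, res_self, map_pow]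

/-- The generator `x` becomes `x^p`. The result permits comparing two maps `Y ⟶ Y₂` by uniqueness.
-/
theorem IsInvertibleIdeal.absFrobenius_comp {X T : Scheme.{u}} {g : T ⟶ X} {I : X.IdealSheafData}
    (t : T ⟶ Spec (CommRingCat.of k)) (h : IsInvertibleIdeal (I.comap g)) :
    IsInvertibleIdeal (I.comap (absFrobenius p t ≫ g)) := by
  refine isInvertibleIdeal_of fun z => ?_
  obtain ⟨U, hU, hz, -⟩ := exists_isAffineOpen_le (Opens.mem_top (g z))
  obtain ⟨x, hx, W, hW, hzW, hgen⟩ := exists_isGeneratorOn h z ⟨U, hU⟩ hz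
  refine ⟨⟨U, hU⟩, x, W, hx, hzW, IsGeneratorOn.of_isAffineOpen hW hgen.le ?_⟩
  have e : W ≤ absFrobenius p t ⁻¹ᵁ W := le_rfl
  have key : ∀ a, pull (absFrobenius p t ≫ g) (V := W) hgen.le a = pull g hgen.le a ^ p := by
    intro a
    rw [← pull_pull _ g hgen.le e, pull_absFrobenius t le_rfl, res_self]
  have h1 := hgen.isGenerator hgen.le
  exact ⟨by rw [key]; exact pow_mem h1.1 p,
    fun a ha => by rw [key, key]; exact pow_dvd_pow_of_dvd (h1.dvd a ha) p⟩

variable {X X₂ : Scheme.{u}} {s : X ⟶ Spec (CommRingCat.of k)} {iX : X ⟶ X₂} {FX : X₂ ⟶ X₂}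

theorem LiftsFrobenius.le_preimage (hF : LiftsFrobenius p s iX FX) (hX : IsThickening p iX)
    (U : X₂.Opens) : U ≤ FX ⁻¹ᵁ U := by
  refine hX.le_of_preimage_le ?_
  rw [← Scheme.Hom.comp_preimage, hF, Scheme.Hom.comp_preimage]
  exact le_refl (iX ⁻¹ᵁ U)

theorem LiftsFrobenius.pull_pull (hF : LiftsFrobenius p s iX FX) {U : X₂.Opens} {V : X.Opens}
    (e : U ≤ FX ⁻¹ᵁ U) (e' : V ≤ iX ⁻¹ᵁ U) (a : Γ(X₂, U)) :
    pull iX e' (pull FX e a) = pull iX e' a ^ p := by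
  have e₂ : V ≤ absFrobenius p s ⁻¹ᵁ V := le_rfl
  rw [FrobLift.pull_pull, pull_congr hF _ (show V ≤ (absFrobenius p s ≫ iX) ⁻¹ᵁ U from e'),
    ← FrobLift.pull_pull _ iX e' e₂, pull_absFrobenius s le_rfl, res_self]

theorem isFrobeniusCompatible_iff (hF : LiftsFrobenius p s iX FX) (hX : IsThickening p iX)
    {J : X₂.IdealSheafData} : IsFrobeniusCompatible p FX J ↔
      ∀ (U : X₂.affineOpens), ∀ a ∈ J.ideal U,
        pull FX (hF.le_preimage hX U.1) a ∈ J.ideal U ^ p := by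
  refine forall_congr' fun U => ?_
  rw [ideal_comap J FX U U (hF.le_preimage hX U.1), Ideal.map_le_iff_le_comap]
  rfl

variable {Y Y₂ : Scheme.{u}} {iY : Y ⟶ Y₂} {π : Y ⟶ X} {π₂ : Y₂ ⟶ X₂} {J : X₂.IdealSheafData}

omit [Fact p.Prime] in
theorem IsThickening.isInvertibleIdeal_comap (hY : IsThickening p iY)
    (h : IsInvertibleIdeal (J.comap π₂)) : IsInvertibleIdeal (J.comap (iY ≫ π₂)) := by
  refine isInvertibleIdeal_of fun z => ?_
  obtain ⟨U, hU, hz, -⟩ := exists_isAffineOpen_le (Opens.mem_top (π₂ (iY z)))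
  obtain ⟨x, hx, W, hW, hzW, hgen⟩ := exists_isGeneratorOn h (iY z) ⟨U, hU⟩ hz
  have e : iY ⁻¹ᵁ W ≤ (iY ≫ π₂) ⁻¹ᵁ U := fun y hy => hgen.le hy
  refine ⟨⟨U, hU⟩, x, iY ⁻¹ᵁ W, hx, hzW,
    IsGeneratorOn.of_isAffineOpen (hY.isAffineOpen hW) e ?_⟩
  have h1 := hgen.isGenerator hgen.le
  refine ⟨?_, fun a ha => ?_⟩
  · rw [← FrobLift.pull_pull iY π₂ hgen.le le_rfl]
    exact (hY.isDeformation W hW).map_mem_nonZeroDivisors h1.1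
  · rw [← FrobLift.pull_pull iY π₂ hgen.le le_rfl, ← FrobLift.pull_pull iY π₂ hgen.le le_rfl]
    exact map_dvd _ (h1.dvd a ha)

theorem isInvertibleIdeal_comap_comp_of_isFrobeniusCompatible (hX : IsThickening p iX)
    (hY : IsThickening p iY) (hF : LiftsFrobenius p s iX FX) (hπ : iY ≫ π₂ = π ≫ iX)
    (hinv : IsInvertibleIdeal (J.comap π₂)) (hc : IsFrobeniusCompatible p FX J) :
    IsInvertibleIdeal (J.comap (π₂ ≫ FX)) := by
  rw [isFrobeniusCompatible_iff hF hX] at hc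
  refine isInvertibleIdeal_of fun z => ?_
  obtain ⟨U, hU, hz, -⟩ := exists_isAffineOpen_le (Opens.mem_top (π₂ z))
  obtain ⟨x, hx, W, hW, hzW, hgen⟩ := exists_isGeneratorOn hinv z ⟨U, hU⟩ hz
  have eF := hF.le_preimage hX U
  have e : W ≤ (π₂ ≫ FX) ⁻¹ᵁ U := fun y hy => eF (hgen.le hy)
  refine ⟨⟨U, hU⟩, x, W, hx, hzW, IsGeneratorOn.of_isAffineOpen hW e ?_⟩
  have h1 := hgen.isGenerator hgen.le
  have hdvd : ∀ a ∈ J.ideal ⟨U, hU⟩, pull π₂ hgen.le x ^ p ∣ pull (π₂ ≫ FX) e a := by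
    intro a ha
    rw [← FrobLift.pull_pull π₂ FX eF hgen.le]
    exact h1.pow_dvd (hc ⟨U, hU⟩ a ha)
  -- So `F(x) = x^p u`. Modulo `p` the left side is `x^p`, so `u ≡ 1` and `u` is a unit. Hence
  -- `F(x)` is as good a generator as `x^p`.
  obtain ⟨u, hu⟩ := hdvd x hx
  have hD := hY.isDeformation W hW
  have hunit : IsUnit u := by
    refine hD.isUnit ?_
    have h2 : pull iY (le_refl (iY ⁻¹ᵁ W)) (pull (π₂ ≫ FX) e x) =
        pull iY (le_refl (iY ⁻¹ᵁ W)) (pull π₂ hgen.le x) ^ p := by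
      have e₁ : iY ⁻¹ᵁ W ≤ π ⁻¹ᵁ iX ⁻¹ᵁ U := by
        rw [← preimage_comm hπ]
        exact fun y hy => hgen.le hy
      have h3 : ∀ a, pull iY (le_refl (iY ⁻¹ᵁ W)) (pull π₂ hgen.le a) =
          pull π e₁ (pull iX le_rfl a) :=
        fun a => RingHom.congr_fun (pull_comm hπ le_rfl hgen.le e₁ le_rfl).symm a
      rw [← FrobLift.pull_pull π₂ FX eF hgen.le, h3, h3, hF.pull_pull, map_pow]
    rw [hu, map_mul, map_pow] at h2
    have h4 := pow_mem (hD.map_mem_nonZeroDivisors h1.1) p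
    have h5 : pull iY (le_refl (iY ⁻¹ᵁ W)) u = 1 :=
      (mul_cancel_left_mem_nonZeroDivisors h4).mp (by rw [h2, mul_one])
    rw [h5]
    exact isUnit_one
  refine ⟨?_, fun a ha => ?_⟩
  · rw [hu]
    exact mul_mem (pow_mem h1.1 p) hunit.mem_nonZeroDivisors
  · rw [hu]
    exact hunit.mul_right_dvd.mpr (hdvd a ha)

/-- A Frobenius lifting which is compatible with the center extends to the blow-up. -/
theorem IsBlowup.exists_liftsFrobenius (hX : IsThickening p iX)
    (hY : IsThickening p iY) (hF : LiftsFrobenius p s iX FX) (hπ : iY ≫ π₂ = π ≫ iX)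
    (hbl : IsBlowup π₂ J) (hc : IsFrobeniusCompatible p FX J) :
    ∃ FY : Y₂ ⟶ Y₂, LiftsFrobenius p (π ≫ s) iY FY ∧ FY ≫ π₂ = π₂ ≫ FX := by
  obtain ⟨FY, hFY : FY ≫ π₂ = π₂ ≫ FX, -⟩ := hbl.existsUnique_lift Y₂ (π₂ ≫ FX)
    (isInvertibleIdeal_comap_comp_of_isFrobeniusCompatible hX hY hF hπ hbl.isInvertibleIdeal hc)
  refine ⟨FY, ?_, hFY⟩
  -- Both `iY ≫ FY` and Frobenius followed by `iY` are maps `Y ⟶ Y₂` with the same composite to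
  -- `X₂`.
  refine (hbl.hom_ext ?_ ?_).symm
  · rw [Category.assoc]
    exact (hY.isInvertibleIdeal_comap hbl.isInvertibleIdeal).absFrobenius_comp _
  · rw [Category.assoc, Category.assoc, hFY, hπ, ← Category.assoc, absFrobenius_comp s,
      Category.assoc, ← hF, ← Category.assoc, ← hπ, Category.assoc]

theorem comap_pow_le (J : X₂.IdealSheafData) (f : Y₂ ⟶ X₂) (n : ℕ) :
    (J ^ n).comap f ≤ J.comap f ^ n := by
  have : ∀ t : Y₂, ∃ W : Y₂.affineOpens, t ∈ W.1 ∧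
      ((J ^ n).comap f).ideal W ≤ (J.comap f ^ n).ideal W := by
    intro t
    obtain ⟨U, hU, htU, -⟩ := exists_isAffineOpen_le (Opens.mem_top (f t))
    obtain ⟨W, hW, htW, e⟩ := exists_isAffineOpen_le (show t ∈ f ⁻¹ᵁ U from htU)
    refine ⟨⟨W, hW⟩, htW, ?_⟩
    rw [ideal_comap _ f ⟨U, hU⟩ ⟨W, hW⟩ e, Scheme.IdealSheafData.ideal_pow,
      Scheme.IdealSheafData.ideal_pow, Pi.pow_apply, Pi.pow_apply, Ideal.map_pow,
      ideal_comap J f ⟨U, hU⟩ ⟨W, hW⟩ e]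
  choose W hW hW' using this
  exact Scheme.IdealSheafData.le_of_iSup_eq_top W
    (eq_top_iff.mpr fun t _ => Opens.mem_iSup.mpr ⟨t, hW t⟩) hW'

omit [Fact p.Prime] in
/-- Compatibility with an ideal sheaf passes to its inverse image. -/
theorem IsFrobeniusCompatible.comap {FY : Y₂ ⟶ Y₂} (hc : IsFrobeniusCompatible p FX J)
    (h : FY ≫ π₂ = π₂ ≫ FX) : IsFrobeniusCompatible p FY (J.comap π₂) := by
  unfold IsFrobeniusCompatible at *
  rw [← Scheme.IdealSheafData.comap_comp, h, Scheme.IdealSheafData.comap_comp]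
  exact le_trans (Scheme.IdealSheafData.comap_mono (f := π₂) hc) (comap_pow_le J π₂ p)

end Frobenius


/-- The relation between the divided differences `a = (F x - x ^ p) / p` and
`a' = (F x' - x' ^ p) / p` which holds if a Frobenius lifting `F` extends to the chart `A[J/x]`. -/
theorem IsDeformation.exists_mem_pow_of_isBlowupAlgebra {p : ℕ} {A A₀ D D₀ : Type*} [CommRing A]
    [CommRing A₀] [CommRing D] [CommRing D₀] {r : A →+* A₀} {rD : D →+* D₀} {φ : A →+* D}
    {φ₀ : A₀ →+* D₀} (hD : IsDeformation p rD)
    (comm : φ₀.comp r = rD.comp φ) {F : A →+* A} {G : D →+* D} (hFG : φ.comp F = G.comp φ)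
    (hG : ∀ d, rD (G d) = rD d ^ p) {J : Ideal A} {x x' a a' : A} (hx : x ∈ J) (hx' : x' ∈ J)
    (hgen : IsGenerator φ J x) {I : Ideal A₀} (hI : J.map r ≤ I)
    (h₀ : IsBlowupAlgebra φ₀ I (r x))
    (ha : F x = x ^ p + p * a) (ha' : F x' = x' ^ p + p * a') :
    ∃ N, r x ^ (N + p) * r a' - r x' ^ p * r x ^ N * r a ∈ I ^ (N + 2 * p) := by
  have hc : ∀ a, φ₀ (r a) = rD (φ a) := fun a => RingHom.congr_fun comm a
  have hF : ∀ a, φ (F a) = G (φ a) := fun a => RingHom.congr_fun hFG a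
  obtain ⟨y, hy⟩ := hgen.dvd x' hx'
  obtain ⟨b, hb⟩ := hD.exists_eq_add (a := G y) (b := y ^ p) (by rw [hG, map_pow])
  -- Expand `F(x') = F(x) G(y)` with `x' = x y` and `G(y) = y^p + p b`; the cross term carries `p² =
  -- 0`.
  have h1 : (p : D) * φ a' = p * (φ a * y ^ p + φ x ^ p * b) := by
    have h2 := hF x'
    rw [hy, map_mul, ← hF, ha, ha', hb] at h2
    simp only [map_add, map_mul, map_pow, map_natCast] at h2
    rw [hy] at h2
    linear_combination h2 + φ a * b * hD.sq_eq_zero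
  have h2 := hD.eq_of_mul h1
  rw [map_add, map_mul, map_mul, map_pow, map_pow, ← hc, ← hc, ← hc] at h2
  have hy₀ : φ₀ (r x') = φ₀ (r x) * rD y := by rw [hc, hc, hy, map_mul]
  obtain ⟨n, β, hβ, hβb⟩ := h₀.exists_pow_mul (rD b)
  obtain ⟨M, hM⟩ := h₀.exists_pow_mul_eq_zero
    (r x ^ (n + p) * r a' - r a * r x ^ n * r x' ^ p - r x ^ (2 * p) * β) (by
      simp only [map_sub, map_mul, map_pow]
      rw [h2, hy₀, ← hβb]
      ring)
  -- The exponent `n` clears the denominator of `b` modulo `p`; `M` kills the `x`-torsion left when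
  -- the identity is pulled back to `A₀`.
  refine ⟨n + M, ?_⟩
  have h3 : r x ^ (n + M + p) * r a' - r x' ^ p * r x ^ (n + M) * r a =
      r x ^ (M + 2 * p) * β := by
    linear_combination hM
  rw [h3, show n + M + 2 * p = (M + 2 * p) + n by ring, pow_add]
  exact Ideal.mul_mem_mul (Ideal.pow_mem_pow (hI (Ideal.mem_map_of_mem r hx)) _) hβ


/-! ### Quasi-regularity of smooth ideals -/

/-- Induct with `f(ab) - g(ab) = f(a)(f(b) - g(b)) + (f(a) - g(a)) g(b)`. Changing coefficients
modulo `M` and variables modulo `M²` does not affect the leading form. -/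
theorem sub_mem_pow_of_mem_pow_idealOfVars {ι R Q : Type*} [CommRing R] [CommRing Q] {M : Ideal Q}
    (f g : MvPolynomial ι R →+* Q) (hC : ∀ c, f (.C c) - g (.C c) ∈ M)
    (hX : ∀ i, f (.X i) - g (.X i) ∈ M ^ 2) (hg : ∀ i, g (.X i) ∈ M) (m : ℕ)
    {F : MvPolynomial ι R} (hF : F ∈ MvPolynomial.idealOfVars ι R ^ m) :
    f F - g F ∈ M ^ (m + 1) := by
  have h0 : ∀ F, f F - g F ∈ M := by
    intro F
    rw [← Ideal.Quotient.eq]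
    refine RingHom.congr_fun (?_ : (Ideal.Quotient.mk M).comp f = (Ideal.Quotient.mk M).comp g) F
    refine MvPolynomial.ringHom_ext (fun c => Ideal.Quotient.eq.mpr (hC c))
      fun i => Ideal.Quotient.eq.mpr (Ideal.pow_le_self two_ne_zero (hX i))
  have hgV : ∀ F ∈ MvPolynomial.idealOfVars ι R, g F ∈ M := by
    intro F hF
    refine (Ideal.span_le.mpr ?_ : MvPolynomial.idealOfVars ι R ≤ M.comap g) hF
    rintro _ ⟨i, rfl⟩
    exact hg i
  have h1 : ∀ F ∈ MvPolynomial.idealOfVars ι R, f F - g F ∈ M ^ 2 := by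
    intro F hF
    refine Submodule.span_induction (p := fun F _ => f F - g F ∈ M ^ 2) ?_ ?_ ?_ ?_ hF
    · rintro _ ⟨i, rfl⟩
      exact hX i
    · simp
    · intro a b _ _ ha hb
      rw [map_add, map_add, add_sub_add_comm]
      exact add_mem ha hb
    · intro a b hb h
      have : f (a • b) - g (a • b) = f a * (f b - g b) + (f a - g a) * g b := by
        rw [smul_eq_mul, map_mul, map_mul]; ring
      rw [this]
      refine add_mem (Ideal.mul_mem_left _ _ h) ?_
      rw [pow_two]
      exact Ideal.mul_mem_mul (h0 a) (hgV b hb)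
  induction m generalizing F with
  | zero => simpa using h0 F
  | succ m ih =>
    rw [pow_succ'] at hF
    refine Submodule.mul_induction_on hF (fun a ha b hb => ?_) fun a b ha hb => ?_
    · have : f (a * b) - g (a * b) = f a * (f b - g b) + (f a - g a) * g b := by
        rw [map_mul, map_mul]; ring
      rw [this]
      refine add_mem ?_ ?_
      · rw [pow_succ']
        refine Ideal.mul_mem_mul ?_ (ih hb)
        have := add_mem (h0 a) (hgV a ha)
        rwa [sub_add_cancel] at this
      · rw [show m + 1 + 1 = 2 + m by ring, pow_add]
        refine Ideal.mul_mem_mul (h1 a ha) ?_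
        have : (MvPolynomial.idealOfVars ι R ^ m).map g ≤ M ^ m := by
          rw [Ideal.map_pow]
          exact Ideal.pow_right_mono (Ideal.map_le_iff_le_comap.mpr hgV) m
        exact this (Ideal.mem_map_of_mem g hb)
    · rw [map_add, map_add, add_sub_add_comm]
      exact add_mem ha hb

theorem mem_idealOfVars_iff {ι R : Type*} [CommRing R] {F : MvPolynomial ι R} :
    F ∈ MvPolynomial.idealOfVars ι R ↔ MvPolynomial.constantCoeff F = 0 := by
  rw [← pow_one (MvPolynomial.idealOfVars ι R), MvPolynomial.mem_pow_idealOfVars_iff',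
    MvPolynomial.constantCoeff_eq]
  refine ⟨fun h => h 0 (by simp), fun h x hx => ?_⟩
  obtain rfl : x = 0 := Finsupp.degree_eq_zero_iff x |>.mp (Nat.lt_one_iff.mp hx)
  exact h

theorem exists_eq_single_of_degree_eq_one {ι : Type*} {α : ι →₀ ℕ} (h : α.degree = 1) :
    ∃ i, α = Finsupp.single i 1 := by
  classical
  have h0 : α ≠ 0 := by rintro rfl; simp at h
  obtain ⟨i, hi⟩ := Finsupp.ne_iff.mp h0
  have hle : Finsupp.single i 1 ≤ α := Finsupp.single_le_iff.mpr (Nat.one_le_iff_ne_zero.mpr hi)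
  refine ⟨i, ?_⟩
  obtain ⟨β, rfl⟩ := exists_add_of_le hle
  rw [map_add, Finsupp.degree_single, Nat.add_eq_left, Finsupp.degree_eq_zero_iff] at h
  rw [h, add_zero]

theorem sub_sum_mem_sq_idealOfVars {ι R : Type*} [Fintype ι] [CommRing R] {F : MvPolynomial ι R}
    (hF : F ∈ MvPolynomial.idealOfVars ι R) :
    F - ∑ i, MvPolynomial.C (F.coeff (Finsupp.single i 1)) * MvPolynomial.X i ∈
      MvPolynomial.idealOfVars ι R ^ 2 := by
  classical
  rw [MvPolynomial.mem_pow_idealOfVars_iff']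
  intro α hα
  simp only [MvPolynomial.coeff_sub, MvPolynomial.coeff_sum, MvPolynomial.coeff_C_mul,
    MvPolynomial.coeff_X, mul_ite, mul_one, mul_zero]
  rcases Nat.lt_succ_iff_lt_or_eq.mp hα with h | h
  · obtain rfl : α = 0 := Finsupp.degree_eq_zero_iff α |>.mp (Nat.lt_one_iff.mp h)
    rw [mem_idealOfVars_iff, MvPolynomial.constantCoeff_eq] at hF
    rw [hF]
    simp
  · obtain ⟨i, rfl⟩ := exists_eq_single_of_degree_eq_one h
    rw [Finset.sum_eq_single i]
    · simp
    · intro j _ hj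
      rw [if_neg]
      intro h'
      exact hj (Finsupp.single_left_injective one_ne_zero h')
    · simp

section QuasiRegular

variable {S B ι : Type*} [CommRing S] [CommRing B] [Algebra S B] [Fintype ι]

/-- `Φ` plays the role of a Taylor expansion along the center. Smoothness of `B` gives a section `σ`
of `S/K² → B`, hence a map from `B[X]` to `S/K²` sending `X_i` to `x_i`. Smoothness of `S` then
lifts `S → S/K²` through the nilpotent thickening `B[X]/V^(n+2)`. The exponent is at least two, so
the truncation still maps to `S/K²`. -/
theorem exists_algHom_quotient (k : Type*) [CommRing k] [Algebra k S] [Algebra k B]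
    [IsScalarTower k S B] [Algebra.FormallySmooth k S] [Algebra.FormallySmooth k B]
    (hsurj : Function.Surjective (algebraMap S B)) {K : Ideal S}
    (hK : ∀ s, algebraMap S B s = 0 ↔ s ∈ K) {x : ι → S} (h1 : K = Ideal.span (Set.range x))
    (h2 : ∀ c : ι → S, ∑ i, c i * x i ∈ K ^ 2 → ∀ i, c i ∈ K) (n : ℕ) :
    ∃ Φ : S →+* MvPolynomial ι B ⧸ MvPolynomial.idealOfVars ι B ^ (n + 2),
      (∀ s, Φ s - Ideal.Quotient.mk _ (.C (algebraMap S B s)) ∈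
        (MvPolynomial.idealOfVars ι B).map (Ideal.Quotient.mk _)) ∧
      ∀ i, Φ (x i) - Ideal.Quotient.mk _ (.X i) ∈
        (MvPolynomial.idealOfVars ι B).map (Ideal.Quotient.mk _) ^ 2 := by
  set V := MvPolynomial.idealOfVars ι B with hV
  have hx : ∀ i, x i ∈ K := fun i => h1 ▸ Ideal.subset_span ⟨i, rfl⟩
  let ρ : S ⧸ K ^ 2 →ₐ[k] B := Ideal.Quotient.liftₐ (K ^ 2) (IsScalarTower.toAlgHom k S B)
    fun s hs => (hK s).mpr (Ideal.pow_le_self two_ne_zero hs)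
  have hρ : ∀ s, ρ (Ideal.Quotient.mk _ s) = algebraMap S B s := fun s => rfl
  have hρ0 : ∀ z, ρ z = 0 → ∃ y ∈ K, Ideal.Quotient.mk (K ^ 2) y = z := by
    intro z hz
    obtain ⟨y, rfl⟩ := Ideal.Quotient.mk_surjective z
    exact ⟨y, (hK y).mp hz, rfl⟩
  have hmk : ∀ y ∈ K, ∀ z ∈ K,
      Ideal.Quotient.mk (K ^ 2) y * Ideal.Quotient.mk (K ^ 2) z = 0 := by
    intro y hy z hz
    rw [← map_mul, Ideal.Quotient.eq_zero_iff_mem, pow_two]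
    exact Ideal.mul_mem_mul hy hz
  have hρnil : IsNilpotent (RingHom.ker (ρ : S ⧸ K ^ 2 →+* B)) := by
    refine ⟨2, le_bot_iff.mp ((pow_two (RingHom.ker _)).le.trans (Ideal.mul_le.mpr ?_))⟩
    intro a ha b hb
    obtain ⟨y, hy, rfl⟩ := hρ0 a ha
    obtain ⟨z, hz, rfl⟩ := hρ0 b hb
    exact hmk y hy z hz
  have hρsurj : Function.Surjective ρ := fun b => by
    obtain ⟨s, rfl⟩ := hsurj b
    exact ⟨_, hρ s⟩
  let σ : B →ₐ[k] S ⧸ K ^ 2 :=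
    Algebra.FormallySmooth.liftOfSurjective (AlgHom.id k B) ρ hρsurj hρnil
  have hσ : ∀ b, ρ (σ b) = b := fun b =>
    Algebra.FormallySmooth.liftOfSurjective_apply (AlgHom.id k B) ρ hρsurj hρnil b
  have hσmul : ∀ s, ∀ y ∈ K, σ (algebraMap S B s) * Ideal.Quotient.mk _ y =
      Ideal.Quotient.mk (K ^ 2) (s * y) := by
    intro s y hy
    obtain ⟨z, hz, hz'⟩ := hρ0 (σ (algebraMap S B s) - Ideal.Quotient.mk _ s)
      (by rw [map_sub, hσ, hρ, sub_self])
    rw [map_mul, ← sub_eq_zero, ← sub_mul, ← hz']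
    exact hmk z hz y hy
  let g₀ : MvPolynomial ι B →ₐ[k] S ⧸ K ^ 2 :=
    MvPolynomial.aevalTower σ fun i => Ideal.Quotient.mk _ (x i)
  have hg₀C : ∀ b, g₀ (.C b) = σ b := fun b => MvPolynomial.aevalTower_C _ _ _
  have hg₀X : ∀ i, g₀ (.X i) = Ideal.Quotient.mk _ (x i) := fun i =>
    MvPolynomial.aevalTower_X _ _ _
  have hρg₀ : ∀ F, ρ (g₀ F) = MvPolynomial.constantCoeff F := by
    refine RingHom.congr_fun
      (?_ : (ρ : S ⧸ K ^ 2 →+* B).comp (g₀ : MvPolynomial ι B →+* S ⧸ K ^ 2) = _)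
    refine MvPolynomial.ringHom_ext (fun b => ?_) fun i => ?_
    · simpa [hg₀C] using hσ b
    · simpa [hg₀X, hρ] using (hK _).mpr (hx i)
  have hVK : V.map (g₀ : MvPolynomial ι B →+* S ⧸ K ^ 2) ≤ K.map (Ideal.Quotient.mk (K ^ 2)) := by
    rw [Ideal.map_le_iff_le_comap, hV, MvPolynomial.idealOfVars, Ideal.span_le]
    rintro _ ⟨i, rfl⟩
    refine Ideal.mem_comap.mpr ?_
    exact (hg₀X i).symm ▸ Ideal.mem_map_of_mem _ (hx i)
  have hV2 : ∀ F ∈ V ^ 2, g₀ F = 0 := by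
    intro F hF
    have := Ideal.mem_map_of_mem (g₀ : MvPolynomial ι B →+* S ⧸ K ^ 2) hF
    rw [Ideal.map_pow] at this
    have := Ideal.pow_right_mono hVK 2 this
    rw [← Ideal.map_pow, Ideal.map_quotient_self] at this
    exact this
  -- Independence of the `x_i` in `K/K²` enters here: the linear part of `F` maps to a relation
  -- among them, so it vanishes.
  have hker : ∀ F ∈ V, g₀ F = 0 → F ∈ V ^ 2 := by
    intro F hF h
    have hd := sub_sum_mem_sq_idealOfVars hF
    choose s hs using hsurj
    have h3 := hV2 _ hd
    rw [map_sub, h, zero_sub, neg_eq_zero, map_sum] at h3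
    have h4 : ∑ i, g₀ (.C (F.coeff (Finsupp.single i 1)) * .X i) =
        Ideal.Quotient.mk (K ^ 2) (∑ i, s (F.coeff (Finsupp.single i 1)) * x i) := by
      rw [map_sum]
      refine Finset.sum_congr rfl fun i _ => ?_
      rw [map_mul, hg₀C, hg₀X, ← hσmul _ _ (hx i), hs]
    rw [h4, Ideal.Quotient.eq_zero_iff_mem] at h3
    have h5 : ∀ i, F.coeff (Finsupp.single i 1) = 0 := fun i => by
      have := (hK _).mpr (h2 _ h3 i)
      rwa [hs] at this
    simpa [h5] using hd
  let g : MvPolynomial ι B ⧸ V ^ (n + 2) →ₐ[k] S ⧸ K ^ 2 :=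
    Ideal.Quotient.liftₐ (V ^ (n + 2)) g₀
      fun F hF => hV2 F (Ideal.pow_le_pow_right (by omega) hF)
  have hg : ∀ F, g (Ideal.Quotient.mk _ F) = g₀ F := fun F => rfl
  have hgsurj : Function.Surjective g := by
    intro z
    obtain ⟨s, rfl⟩ := Ideal.Quotient.mk_surjective z
    obtain ⟨y, hy, hy'⟩ := hρ0 (Ideal.Quotient.mk _ s - σ (algebraMap S B s))
      (by rw [map_sub, hσ, hρ, sub_self])
    have hy2 := hy
    rw [h1, Ideal.mem_span_range_iff_exists_fun] at hy2
    obtain ⟨t, rfl⟩ := hy2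
    refine ⟨Ideal.Quotient.mk _ (.C (algebraMap S B s) +
      ∑ i, .C (algebraMap S B (t i)) * .X i), ?_⟩
    rw [hg, map_add, map_sum, hg₀C, ← eq_sub_iff_add_eq', ← hy', map_sum]
    refine Finset.sum_congr rfl fun i _ => ?_
    rw [map_mul, hg₀C, hg₀X, hσmul _ _ (hx i)]
  have hgker : ∀ F, g (Ideal.Quotient.mk _ F) = 0 → F ∈ V := by
    intro F hF
    rw [hg] at hF
    rw [hV, mem_idealOfVars_iff, ← hρg₀, hF, map_zero]
  have hgnil : IsNilpotent (RingHom.ker (g : MvPolynomial ι B ⧸ V ^ (n + 2) →+* S ⧸ K ^ 2)) := by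
    refine ⟨n + 2, ?_⟩
    have h3 : RingHom.ker (g : MvPolynomial ι B ⧸ V ^ (n + 2) →+* S ⧸ K ^ 2) ≤
        V.map (Ideal.Quotient.mk _) := by
      intro z hz
      obtain ⟨F, rfl⟩ := Ideal.Quotient.mk_surjective z
      exact Ideal.mem_map_of_mem _ (hgker F hz)
    rw [Ideal.zero_eq_bot, eq_bot_iff]
    refine (Ideal.pow_right_mono h3 (n + 2)).trans ?_
    rw [← Ideal.map_pow, Ideal.map_quotient_self]
  let Φ : S →ₐ[k] MvPolynomial ι B ⧸ V ^ (n + 2) :=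
    Algebra.FormallySmooth.liftOfSurjective (Ideal.Quotient.mkₐ k (K ^ 2)) g hgsurj hgnil
  have hΦ : ∀ s, g (Φ s) = Ideal.Quotient.mk _ s := fun s =>
    Algebra.FormallySmooth.liftOfSurjective_apply (Ideal.Quotient.mkₐ k (K ^ 2)) g hgsurj hgnil s
  refine ⟨Φ, fun s => ?_, fun i => ?_⟩
  · obtain ⟨F, hF⟩ := Ideal.Quotient.mk_surjective (Φ s)
    have h3 := hΦ s
    rw [← hF, hg] at h3
    change Φ s - _ ∈ _
    rw [← hF, ← map_sub]
    refine Ideal.mem_map_of_mem _ ?_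
    rw [hV, mem_idealOfVars_iff, map_sub, ← hρg₀, h3, hρ, MvPolynomial.constantCoeff_C, sub_self]
  · obtain ⟨F, hF⟩ := Ideal.Quotient.mk_surjective (Φ (x i))
    have h3 := hΦ (x i)
    rw [← hF, hg] at h3
    change Φ (x i) - _ ∈ _
    rw [← hF, ← map_sub, ← Ideal.map_pow]
    refine Ideal.mem_map_of_mem _ ?_
    have h4 : g₀ (F - .X i) = 0 := by rw [map_sub, h3, hg₀X, sub_self]
    exact hker _ (hgker _ (by rw [hg, h4])) h4

/-- If `K` is generated by elements which form a basis of the conormal module of a formally smooth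
quotient, then these elements are quasi-regular. -/
theorem coeff_mem_of_eval_mem_pow (k : Type*) [CommRing k] [Algebra k S] [Algebra k B]
    [IsScalarTower k S B] [Algebra.FormallySmooth k S] [Algebra.FormallySmooth k B]
    (hsurj : Function.Surjective (algebraMap S B)) {K : Ideal S}
    (hK : ∀ s, algebraMap S B s = 0 ↔ s ∈ K) {x : ι → S} (h1 : K = Ideal.span (Set.range x))
    (h2 : ∀ c : ι → S, ∑ i, c i * x i ∈ K ^ 2 → ∀ i, c i ∈ K) {m : ℕ} {F : MvPolynomial ι S}
    (hF : F.IsHomogeneous m) (h : MvPolynomial.eval x F ∈ K ^ (m + 1)) (α : ι →₀ ℕ) :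
    F.coeff α ∈ K := by
  by_cases hα : α.degree = m
  swap
  · rw [hF.coeff_eq_zero hα]
    exact zero_mem K
  obtain ⟨Φ, hΦ, hΦx⟩ := exists_algHom_quotient k hsurj hK h1 h2 m
  let V := MvPolynomial.idealOfVars ι B
  let M := V.map (Ideal.Quotient.mk (V ^ (m + 2)))
  have hFV : F ∈ MvPolynomial.idealOfVars ι S ^ m := by
    rw [MvPolynomial.mem_pow_idealOfVars_iff']
    intro β hβ
    exact hF.coeff_eq_zero hβ.ne
  have key := sub_mem_pow_of_mem_pow_idealOfVars (M := M) (Φ.comp (MvPolynomial.eval x))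
    ((Ideal.Quotient.mk (V ^ (m + 2))).comp (MvPolynomial.map (algebraMap S B)))
    (fun c => by simpa using hΦ c) (fun i => by simpa using hΦx i)
    (fun i => by
      rw [RingHom.comp_apply, MvPolynomial.map_X]
      exact Ideal.mem_map_of_mem (Ideal.Quotient.mk (V ^ (m + 2)))
        (Ideal.subset_span ⟨i, rfl⟩ : (.X i : MvPolynomial ι B) ∈ V)) m hFV
  have hKM : K.map Φ ≤ M := by
    refine Ideal.map_le_iff_le_comap.mpr fun y hy => ?_
    have := hΦ y
    rwa [(hK y).mpr hy, map_zero, map_zero, sub_zero] at this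
  have h3 : Φ (MvPolynomial.eval x F) ∈ M ^ (m + 1) := by
    have := Ideal.mem_map_of_mem Φ h
    rw [Ideal.map_pow] at this
    exact Ideal.pow_right_mono hKM _ this
  have h4 := sub_mem h3 key
  rw [RingHom.comp_apply, sub_sub_cancel] at h4
  -- As `V^(m+2) ⊆ V^(m+1)`, the truncation loses nothing: the reduction of `F` lies in `V^(m+1)`,
  -- so its coefficients in degree `m` vanish.
  rw [← Ideal.map_pow, RingHom.comp_apply, Ideal.mem_quotient_iff_mem_sup,
    sup_eq_left.mpr (Ideal.pow_le_pow_right (Nat.le_succ _)),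
    MvPolynomial.mem_pow_idealOfVars_iff'] at h4
  have h5 := h4 α (by omega)
  rw [MvPolynomial.coeff_map] at h5
  exact (hK _).mp h5

end QuasiRegular


/-! ### Leading forms in the associated graded ring. -/

section QuasiRegularFamily

variable {S ι : Type*} [CommRing S]

/-- A family of generators of `K` is quasi-regular if the associated graded ring of `K` is a
polynomial ring in their classes. -/
structure IsQuasiRegularFamily (K : Ideal S) (x : ι → S) : Prop where
  eq_span : K = Ideal.span (Set.range x)
  coeff_mem : ∀ (m : ℕ) (F : MvPolynomial ι S), F.IsHomogeneous m →
    MvPolynomial.eval x F ∈ K ^ (m + 1) → ∀ α, F.coeff α ∈ K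

namespace IsQuasiRegularFamily

variable {K : Ideal S} {x : ι → S}

theorem mem (h : IsQuasiRegularFamily K x) (i : ι) : x i ∈ K :=
  h.eq_span ▸ Ideal.subset_span ⟨i, rfl⟩

theorem exists_isHomogeneous (h : IsQuasiRegularFamily K x) {m : ℕ} {s : S} (hs : s ∈ K ^ m) :
    ∃ F : MvPolynomial ι S, F.IsHomogeneous m ∧ MvPolynomial.eval x F = s := by
  rwa [h.eq_span, Ideal.mem_span_pow_iff_exists_isHomogeneous] at hs

theorem eval_mem_pow (h : IsQuasiRegularFamily K x) {m : ℕ} {F : MvPolynomial ι S}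
    (hF : F.IsHomogeneous m) (hc : ∀ α, F.coeff α ∈ K) : MvPolynomial.eval x F ∈ K ^ (m + 1) := by
  rw [MvPolynomial.eval_eq]
  refine sum_mem fun α hα => ?_
  rw [pow_succ']
  refine Ideal.mul_mem_mul (hc α) ?_
  have hdeg : α.degree = m := by
    by_contra h'
    exact MvPolynomial.mem_support_iff.mp hα (hF.coeff_eq_zero h')
  rw [← hdeg, Finsupp.degree_apply, ← Finset.prod_pow_eq_pow_sum]
  exact Ideal.prod_mem_prod fun i _ => Ideal.pow_mem_pow (h.mem i) _

/-- A variable is a non-zero-divisor in the polynomial ring that is the associated graded ring. The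
order of `s` is raised one step at a time by comparing the coefficients of `F` and `X_i F`. -/
theorem mem_pow_of_mul_mem (h : IsQuasiRegularFamily K x) (i : ι) {m : ℕ} {s : S}
    (hs : x i * s ∈ K ^ (m + 1)) : s ∈ K ^ m := by
  suffices ∀ l ≤ m, s ∈ K ^ l from this m le_rfl
  intro l hl
  induction l with
  | zero => simp
  | succ l ih =>
    obtain ⟨F, hF, rfl⟩ := h.exists_isHomogeneous (ih (by omega))
    refine h.eval_mem_pow hF fun α => ?_
    have := h.coeff_mem (1 + l) (MvPolynomial.X i * F)
      ((MvPolynomial.isHomogeneous_X S i).mul hF) (by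
      rw [map_mul, MvPolynomial.eval_X]
      exact Ideal.pow_le_pow_right (by omega) hs) (Finsupp.single i 1 + α)
    rwa [MvPolynomial.coeff_X_mul] at this

theorem mem_pow_of_pow_mul_mem (h : IsQuasiRegularFamily K x) (i : ι) {n m : ℕ} {s : S}
    (hs : x i ^ n * s ∈ K ^ (n + m)) : s ∈ K ^ m := by
  induction n generalizing s with
  | zero => simpa using hs
  | succ n ih =>
    refine ih (h.mem_pow_of_mul_mem i ?_)
    rwa [← mul_assoc, ← pow_succ', show n + m + 1 = n + 1 + m by ring]

theorem mem_pow_succ_of_sub_mem (h : IsQuasiRegularFamily K x) {i j : ι} (hij : i ≠ j) {p m : ℕ}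
    (hm : m < p) {s t : S} (hs : s ∈ K ^ m) (ht : t ∈ K ^ m)
    (hst : x i ^ p * s - x j ^ p * t ∈ K ^ (p + m + 1)) : s ∈ K ^ (m + 1) := by
  classical
  obtain ⟨F, hF, rfl⟩ := h.exists_isHomogeneous hs
  obtain ⟨G, hG, rfl⟩ := h.exists_isHomogeneous ht
  refine h.eval_mem_pow hF fun α => ?_
  by_cases hα : α.degree = m
  swap
  · rw [hF.coeff_eq_zero hα]
    exact zero_mem K
  have hX : ∀ i, (MvPolynomial.X i ^ p : MvPolynomial ι S).IsHomogeneous p :=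
    fun i => MvPolynomial.isHomogeneous_X_pow i p
  have key := h.coeff_mem (p + m) (MvPolynomial.X i ^ p * F - MvPolynomial.X j ^ p * G)
    (((hX i).mul hF).sub ((hX j).mul hG)) (by simpa using hst) (Finsupp.single i p + α)
  -- Since `α` has degree `m < p`, the monomial `X_i^p X^α` is not divisible by `X_j^p`. Its
  -- coefficient therefore comes from `F` alone.
  have hj : ¬ Finsupp.single j p ≤ Finsupp.single i p + α := by
    intro hle
    have h1 := hle j
    rw [Finsupp.single_eq_same, Finsupp.add_apply, Finsupp.single_eq_of_ne' hij, zero_add] at h1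
    have h2 := Finsupp.le_degree j α
    omega
  rw [MvPolynomial.coeff_sub, MvPolynomial.X_pow_eq_monomial, MvPolynomial.X_pow_eq_monomial,
    MvPolynomial.coeff_monomial_mul, one_mul, MvPolynomial.coeff_monomial_mul', if_neg hj,
    sub_zero] at key
  exact key

/-- If the divided differences `a` satisfy the relations coming from the charts of the blow-up of a
quasi-regular ideal in at least two generators, then they lie in the `p`-th power of the ideal. -/
theorem mem_pow_of_relation [Nontrivial ι] {τ : Type*} {v : τ → S} {c : ι → τ}
    (h : IsQuasiRegularFamily K fun i => v (c i)) (hv : ∀ t, v t ∈ K) {p : ℕ} {a : τ → S}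
    (hrel : ∀ s t, ∃ N, v s ^ (N + p) * a t - v t ^ p * v s ^ N * a s ∈ K ^ (N + 2 * p)) (t : τ) :
    a t ∈ K ^ p := by
  have h1 : ∀ i t, v (c i) ^ p * a t - v t ^ p * a (c i) ∈ K ^ (p + p) := by
    intro i t
    obtain ⟨N, hN⟩ := hrel (c i) t
    refine h.mem_pow_of_pow_mul_mem i (n := N) ?_
    rw [← two_mul]
    convert hN using 1
    ring
  -- Raise the order of all `a (c i)` together, comparing each with a second index `j`. The step
  -- needs `p + m + 1 ≤ 2p`, so it stops exactly at `m = p`.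
  have h2 : ∀ m ≤ p, ∀ i, a (c i) ∈ K ^ m := by
    intro m
    induction m with
    | zero => simp
    | succ m ih =>
      intro hm i
      obtain ⟨j, hj⟩ := exists_ne i
      exact h.mem_pow_succ_of_sub_mem hj (by omega) (ih (by omega) i) (ih (by omega) j)
        (Ideal.pow_le_pow_right (by omega) (h1 j (c i)))
  obtain ⟨i, -⟩ := exists_pair_ne ι
  refine h.mem_pow_of_pow_mul_mem i (n := p) ?_
  have h3 : v t ^ p * a (c i) ∈ K ^ (p + p) := by
    rw [pow_add]
    exact Ideal.mul_mem_mul (Ideal.pow_mem_pow (hv t) p) (h2 p le_rfl i)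
  have := add_mem (h1 i t) h3
  rwa [sub_add_cancel] at this

end IsQuasiRegularFamily

end QuasiRegularFamily


/-! ### From smoothness and codimension to quasi-regular generators. -/

section LocalRing

variable {k B : Type*} [CommRing k] [CommRing B] [Algebra k B] [Algebra.FormallySmooth k B]

/-- The conormal module of a formally smooth quotient is projective. -/
theorem projective_cotangent (P : Algebra.Extension k B) [Algebra.FormallySmooth k P.Ring] :
    Module.Projective B P.Cotangent := by
  obtain ⟨l, hl⟩ := P.formallySmooth_iff_split_injection.mp ‹_›
  have : Module.Projective B P.CotangentSpace := inferInstance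
  exact Module.Projective.of_split _ l hl

/-- Over the local ring `B` the projective conormal module is free, and a basis can be selected from
the classes of the given generators. Nakayama makes the selected elements generate the kernel;
independence in the conormal module makes them quasi-regular. -/
theorem exists_isQuasiRegularFamily (P : Algebra.Extension k B) [Algebra.FormallySmooth k P.Ring]
    [IsLocalRing P.Ring] [IsNoetherianRing P.Ring] [Nontrivial B] {τ : Type u} {v : τ → P.Ring}
    (hv : P.ker = Ideal.span (Set.range v)) :
    ∃ (ι : Type u) (c : ι → τ), IsQuasiRegularFamily P.ker fun i => v (c i) := by
  have hsurj := P.algebraMap_surjective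
  have hvmem : ∀ t, v t ∈ P.ker := fun t => hv ▸ Ideal.subset_span ⟨t, rfl⟩
  have : IsLocalRing B := IsLocalRing.of_surjective' (algebraMap P.Ring B) hsurj
  have : IsNoetherianRing B := isNoetherianRing_of_surjective _ _ (algebraMap P.Ring B) hsurj
  have hproj := projective_cotangent P
  have hspan := Algebra.Extension.Cotangent.span_eq_top_of_span_eq_ker v hv.symm
  have : Module.Finite P.Ring P.Cotangent :=
    Module.Finite.of_surjective Algebra.Extension.Cotangent.mk
      Algebra.Extension.Cotangent.mk_surjective
  have : Module.Finite B P.Cotangent := Module.Finite.of_restrictScalars_finite P.Ring B _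
  have : Module.FinitePresentation B P.Cotangent := Module.finitePresentation_of_finite B _
  obtain ⟨ι, c, b, hb⟩ := Module.exists_basis_of_span_of_flat _ hspan
  have := Module.Finite.finite_basis b
  have := Fintype.ofFinite ι
  have hmem : ∀ i, v (c i) ∈ P.ker := fun i => hvmem (c i)
  have hmk : ∀ s : ι → P.Ring, ∑ i, algebraMap P.Ring B (s i) • b i =
      Algebra.Extension.Cotangent.mk (∑ i, s i • ⟨v (c i), hmem i⟩) := by
    intro s
    rw [map_sum]
    refine Finset.sum_congr rfl fun i _ => ?_
    rw [map_smul, hb, algebraMap_smul]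
  have hval : ∀ s : ι → P.Ring,
      ((∑ i, s i • ⟨v (c i), hmem i⟩ : P.ker) : P.Ring) = ∑ i, s i * v (c i) := by
    intro s
    rw [AddSubmonoidClass.coe_finsetSum]
    rfl
  have h1 : P.ker = Ideal.span (Set.range fun i => v (c i)) := by
    refine le_antisymm ?_ (Ideal.span_le.mpr ?_)
    · refine Submodule.le_of_le_smul_of_le_jacobson_bot (I := P.ker)
        (IsNoetherian.noetherian P.ker) ?_ fun y hy => ?_
      · rw [IsLocalRing.jacobson_eq_maximalIdeal ⊥ bot_ne_top]
        refine IsLocalRing.le_maximalIdeal ?_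
        exact RingHom.ker_ne_top _
      · have h2 := b.sum_repr (Algebra.Extension.Cotangent.mk ⟨y, hy⟩)
        choose s hs using hsurj
        have h3 := hmk fun i => s (b.repr (Algebra.Extension.Cotangent.mk ⟨y, hy⟩) i)
        simp only [hs] at h3
        rw [h2, Algebra.Extension.Cotangent.mk_eq_mk_iff_sub_mem, hval] at h3
        rw [← sub_add_cancel y (∑ i, _ * v (c i)), add_comm]
        refine Submodule.add_mem_sup (sum_mem fun i _ => ?_) ?_
        · exact Ideal.mul_mem_left _ _ (Ideal.subset_span ⟨i, rfl⟩)
        · rwa [smul_eq_mul, ← pow_two]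
    · rintro _ ⟨i, rfl⟩
      exact hmem i
  have h2 : ∀ s : ι → P.Ring, ∑ i, s i * v (c i) ∈ P.ker ^ 2 → ∀ i, s i ∈ P.ker := by
    intro s hs i
    rw [← hval, ← Algebra.Extension.Cotangent.mk_eq_zero_iff, ← hmk] at hs
    exact Fintype.linearIndependent_iff.mp b.linearIndependent _ hs i
  exact ⟨ι, c, h1, fun m F hF h α =>
    coeff_mem_of_eval_mem_pow k hsurj (fun s => Iff.rfl) h1 h2 hF h α⟩

/-- The divided differences `a` of generators `v` of the kernel of a smooth quotient of a local ring
lie in the `p`-th power of the kernel if they satisfy the relations coming from the charts of the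
blow-up. -/
theorem mem_ker_pow_of_relation (P : Algebra.Extension k B)
    [Algebra.FormallySmooth k P.Ring] [IsLocalRing P.Ring] [IsNoetherianRing P.Ring] [Nontrivial B]
    (hht : ∀ q : Ideal P.Ring, q.IsPrime → P.ker ≤ q → 1 < q.height)
    {τ : Type u} {v : τ → P.Ring} (hv : P.ker = Ideal.span (Set.range v)) {p : ℕ} {a : τ → P.Ring}
    (hrel : ∀ s t, ∃ N, v s ^ (N + p) * a t - v t ^ p * v s ^ N * a s ∈ P.ker ^ (N + 2 * p))
    (t : τ) : a t ∈ P.ker ^ p := by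
  obtain ⟨ι, c, h⟩ := exists_isQuasiRegularFamily P hv
  -- With at most one generator the ideal is principal, and Krull's principal ideal theorem bounds
  -- the height of a minimal prime over it by one, against the codimension hypothesis.
  have : Nontrivial ι := by
    by_contra hι
    rw [not_nontrivial_iff_subsingleton] at hι
    have hprin : P.ker.IsPrincipal := by
      rw [h.eq_span]
      rcases isEmpty_or_nonempty ι with h0 | ⟨⟨i⟩⟩
      · rw [Set.range_eq_empty, Ideal.span_empty]
        exact bot_isPrincipal
      · have : Unique ι := uniqueOfSubsingleton i
        rw [Set.range_unique]
        exact ⟨_, rfl⟩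
    obtain ⟨q, hq⟩ := Ideal.nonempty_minimalPrimes (RingHom.ker_ne_top (algebraMap P.Ring B))
    exact absurd (hht q hq.1.1 hq.1.2)
      (not_lt.mpr (Ideal.height_le_one_of_isPrincipal_of_mem_minimalPrimes P.ker q hq))
  exact h.mem_pow_of_relation (fun t => hv ▸ Ideal.subset_span ⟨t, rfl⟩) hrel t

end LocalRing

theorem mem_pow_of_relation_of_isLocalRing {k : Type*} {S : Type u} [CommRing k] [CommRing S]
    [Algebra k S] [IsLocalRing S] [IsNoetherianRing S] [Algebra.FormallySmooth k S] {K : Ideal S}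
    [Algebra.FormallySmooth k (S ⧸ K)] (hK : K ≠ ⊤)
    (hht : ∀ q : Ideal S, q.IsPrime → K ≤ q → 1 < q.height) {τ : Type u} {v : τ → S}
    (hv : K = Ideal.span (Set.range v)) {p : ℕ} {a : τ → S}
    (hrel : ∀ s t, ∃ N, v s ^ (N + p) * a t - v t ^ p * v s ^ N * a s ∈ K ^ (N + 2 * p)) (t : τ) :
    a t ∈ K ^ p := by
  have : Nontrivial (S ⧸ K) := Ideal.Quotient.nontrivial_iff.mpr hK
  let P : Algebra.Extension k (S ⧸ K) :=
    Algebra.Extension.ofSurjective (Ideal.Quotient.mkₐ k K) Ideal.Quotient.mk_surjective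
  let L : Ideal S := P.ker
  have hL : L = K := Ideal.ext fun s => Ideal.Quotient.eq_zero_iff_mem (I := K)
  have : Algebra.FormallySmooth k P.Ring := ‹Algebra.FormallySmooth k S›
  have : IsLocalRing P.Ring := ‹IsLocalRing S›
  have : IsNoetherianRing P.Ring := ‹IsNoetherianRing S›
  have key : (∀ q : Ideal S, q.IsPrime → L ≤ q → 1 < q.height) →
      L = Ideal.span (Set.range v) →
      (∀ s t, ∃ N, v s ^ (N + p) * a t - v t ^ p * v s ^ N * a s ∈ L ^ (N + 2 * p)) →
      a t ∈ L ^ p := fun h₁ h₂ h₃ =>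
    mem_ker_pow_of_relation P h₁ (v := v) h₂ (a := a) h₃ t
  rw [hL] at key
  exact key hht hv hrel

/-- Let `I` be the ideal of a smooth closed subscheme of codimension greater than one of a smooth
affine scheme. If the divided differences `a` of generators `v` of `I` satisfy the relations coming
from the charts of the blow-up of `I`, then they lie in `I ^ p`. -/
theorem mem_pow_of_relation {k : Type*} {R : Type u} [CommRing k] [CommRing R] [Algebra k R]
    [IsNoetherianRing R] [Algebra.FormallySmooth k R] {I : Ideal R}
    [Algebra.FormallySmooth k (R ⧸ I)]
    (hht : ∀ q : Ideal R, q.IsPrime → I ≤ q → 1 < q.height) {τ : Type u} {v : τ → R}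
    (hv : I = Ideal.span (Set.range v)) {p : ℕ} {a : τ → R}
    (hrel : ∀ s t, ∃ N, v s ^ (N + p) * a t - v t ^ p * v s ^ N * a s ∈ I ^ (N + 2 * p)) (t : τ) :
    a t ∈ I ^ p := by
  refine Ideal.mem_of_localization_maximal fun q hq => ?_
  let S := Localization.AtPrime q
  let K : Ideal S := I.map (algebraMap R S)
  have hpow : ∀ n, (I ^ n).map (algebraMap R S) = K ^ n := fun n => Ideal.map_pow _ _ n
  change algebraMap R S (a t) ∈ (I ^ p).map (algebraMap R S)
  rw [hpow]
  -- Away from the center `I` localizes to the unit ideal, so only primes containing `I` need the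
  -- local result.
  by_cases hIq : I ≤ q
  swap
  · obtain ⟨y, hy, hyq⟩ := Set.not_subset.mp hIq
    have : K = ⊤ := Ideal.eq_top_of_isUnit_mem _ (Ideal.mem_map_of_mem (algebraMap R S) hy)
      (IsLocalization.map_units S (⟨y, hyq⟩ : q.primeCompl))
    rw [this, Ideal.top_pow]
    trivial
  have : Algebra.FormallySmooth (R ⧸ I) (S ⧸ K) :=
    Algebra.FormallySmooth.of_isLocalization (Algebra.algebraMapSubmonoid (R ⧸ I) q.primeCompl)
  have : IsScalarTower k (R ⧸ I) (S ⧸ K) := IsScalarTower.of_algebraMap_eq fun x => rfl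
  have : Algebra.FormallySmooth k (S ⧸ K) := Algebra.FormallySmooth.comp k (R ⧸ I) (S ⧸ K)
  have : Algebra.FormallySmooth k S := inferInstance
  have : IsNoetherianRing S := IsLocalization.isNoetherianRing q.primeCompl S inferInstance
  have hK : K ≠ ⊤ := by
    refine ne_top_of_le_ne_top (IsLocalRing.maximalIdeal.isMaximal S).ne_top
      ((Ideal.map_mono hIq).trans ?_)
    rw [Localization.AtPrime.map_eq_maximalIdeal]
  refine mem_pow_of_relation_of_isLocalRing (k := k) hK ?_ (p := p)
    (v := fun s => algebraMap R S (v s)) (a := fun s => algebraMap R S (a s)) ?_ ?_ t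
  · intro Q hQ hKQ
    have := IsLocalization.height_under q.primeCompl (A := S) Q
    refine lt_of_lt_of_eq (hht (Ideal.under R Q) inferInstance ?_) this
    exact Ideal.map_le_iff_le_comap.mp hKQ
  · change I.map _ = _
    rw [hv, Ideal.map_span, ← Set.range_comp]
    rfl
  · intro s t
    obtain ⟨N, hN⟩ := hrel s t
    refine ⟨N, ?_⟩
    rw [← hpow]
    have := Ideal.mem_map_of_mem (algebraMap R S) hN
    simpa only [map_sub, map_mul, map_pow] using this


theorem mem_pow_of_relation_of_smooth {k A C : Type u} [CommRing k] [IsNoetherianRing k]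
    [CommRing A] [CommRing C] {f : k →+* A} {g : A →+* C} (hf : f.Smooth) (hgf : (g.comp f).Smooth)
    (hg : Function.Surjective g)
    (hht : ∀ q : Ideal A, q.IsPrime → RingHom.ker g ≤ q → 1 < q.height) {τ : Type u} {v : τ → A}
    (hv : RingHom.ker g = Ideal.span (Set.range v)) {p : ℕ} {a : τ → A}
    (hrel : ∀ s t, ∃ N, v s ^ (N + p) * a t - v t ^ p * v s ^ N * a s ∈
      RingHom.ker g ^ (N + 2 * p)) (t : τ) : a t ∈ RingHom.ker g ^ p := by
  let := f.toAlgebra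
  let := (g.comp f).toAlgebra
  have : Algebra.Smooth k A := hf
  have : Algebra.Smooth k C := hgf
  have : IsNoetherianRing A := Algebra.FiniteType.isNoetherianRing k A
  let g' : A →ₐ[k] C := { g with commutes' := fun _ => rfl }
  have : Algebra.FormallySmooth k (A ⧸ RingHom.ker g') :=
    Algebra.FormallySmooth.of_equiv (Ideal.quotientKerAlgEquivOfSurjective (f := g') hg).symm
  exact mem_pow_of_relation (k := k) (I := RingHom.ker g') hht hv hrel t

/-- The height of a prime containing the ideal of a closed subscheme, in terms of the dimension of
the local rings. -/
theorem one_lt_height_of_ker_le {X Z : Scheme.{u}} (j : Z ⟶ X) [IsClosedImmersion j]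
    (hcodim : ∀ z : Z, 1 < ringKrullDim (X.presheaf.stalk (j z))) {U : X.Opens}
    (hU : IsAffineOpen U) (q : Ideal Γ(X, U)) (hq : q.IsPrime)
    (hle : RingHom.ker (pull j (le_refl (j ⁻¹ᵁ U))) ≤ q) : 1 < q.height := by
  have hsurj : Function.Surjective (pull j (le_refl (j ⁻¹ᵁ U))) := by
    have := j.app_surjective U hU
    rwa [Scheme.Hom.app_eq_appLE] at this
  obtain ⟨q', hq'⟩ : (⟨q, hq⟩ : PrimeSpectrum Γ(X, U)) ∈
      Set.range (PrimeSpectrum.comap (pull j (le_refl (j ⁻¹ᵁ U)))) := by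
    rw [_root_.range_comap_of_surjective _ _ hsurj]
    exact hle
  have hpt : j ((hU.preimage j).fromSpec q') = hU.fromSpec ⟨q, hq⟩ := by
    have : hU.fromSpec (PrimeSpectrum.comap (pull j (le_refl (j ⁻¹ᵁ U))) q') =
        j ((hU.preimage j).fromSpec q') :=
      congr($(IsAffineOpen.SpecMap_appLE_fromSpec j hU (hU.preimage j) le_rfl) q')
    rw [← this, hq']
  have hmem : hU.fromSpec ⟨q, hq⟩ ∈ U := by
    rw [← SetLike.mem_coe, ← hU.range_fromSpec]
    exact ⟨_, rfl⟩
  have h1 := hcodim ((hU.preimage j).fromSpec q')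
  rw [hpt] at h1
  have h2 := @IsLocalization.AtPrime.ringKrullDim_eq_height _ _ q hq
    (X.presheaf.stalk (hU.fromSpec ⟨q, hq⟩)) _
    (TopCat.Presheaf.algebra_section_stalk X.presheaf (⟨_, hmem⟩ : U)) (hU.isLocalization_stalk' ⟨q, hq⟩ hmem)
  rw [h2] at h1
  exact_mod_cast h1

/-! ### From a Frobenius lifting on the blow-up to compatibility with the center. -/

variable {p : ℕ} [Fact p.Prime] {k : Type u} [Field k] [CharP k p]

/-- If a Frobenius lifting extends to the blow-up, then it is compatible with the center. -/
theorem isFrobeniusCompatible_of_liftsFrobenius {X X₂ Y Y₂ Z : Scheme.{u}}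
    {s : X ⟶ Spec (CommRingCat.of k)} {j : Z ⟶ X} [IsClosedImmersion j] [Smooth s] [Smooth (j ≫ s)]
    (hcodim : ∀ z : Z, 1 < ringKrullDim (X.presheaf.stalk (j z)))
    {iX : X ⟶ X₂} {iY : Y ⟶ Y₂} {π : Y ⟶ X} {π₂ : Y₂ ⟶ X₂}
    {hX : IsThickening p iX} {hY : IsThickening p iY}
    {J : X₂.IdealSheafData} {L : Y₂.IdealSheafData}
    (hπ : iY ≫ π₂ = π ≫ iX) (hJ : LiftsIdeal hX j.ker J)
    (hL : LiftsIdeal hY (j.ker.comap π) L) (hJL : J.comap π₂ ≤ L) (hbl : IsBlowup π j.ker)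
    (hbl₂ : IsBlowup π₂ J) {FX : X₂ ⟶ X₂} {FY : Y₂ ⟶ Y₂} (hFX : LiftsFrobenius p s iX FX)
    (hFY : LiftsFrobenius p (π ≫ s) iY FY) (hF : FY ≫ π₂ = π₂ ≫ FX) :
    IsFrobeniusCompatible p FX J := by
  rw [isFrobeniusCompatible_iff hFX hX]
  rintro ⟨U, hU⟩ x hx
  have hA := hX.isDeformation U hU
  set r := pull iX (le_refl (iX ⁻¹ᵁ U)) with hr
  have eF := hFX.le_preimage hX U
  have hdiff : ∀ x, ∃ a, pull FX eF x = x ^ p + p * a := fun x =>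
    hA.exists_eq_add (by rw [hFX.pull_pull, map_pow])
  choose a ha using hdiff
  have hI : j.ker.ideal ⟨iX ⁻¹ᵁ U, hX.isAffineOpen hU⟩ =
      RingHom.ker (pull j (le_refl (j ⁻¹ᵁ iX ⁻¹ᵁ U))) := ker_pull j _ rfl
  have hIJ := hJ.map_eq U hU
  -- All elements of `J` serve at once as the generating family, so every element comes with its own
  -- chart.
  have key : ∀ t : J.ideal ⟨U, hU⟩, r (a t) ∈
      RingHom.ker (pull j (le_refl (j ⁻¹ᵁ iX ⁻¹ᵁ U))) ^ p := by
    have e₁ : iX ⁻¹ᵁ U ≤ s ⁻¹ᵁ ⊤ := le_top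
    have : IsNoetherianRing Γ(Spec (CommRingCat.of k), ⊤) :=
      isNoetherianRing_of_ringEquiv k
        (Scheme.ΓSpecIso (CommRingCat.of k)).symm.commRingCatIsoToRingEquiv
    refine mem_pow_of_relation_of_smooth (f := pull s e₁) (v := fun t : J.ideal ⟨U, hU⟩ => r t)
      (s.smooth_appLE (isAffineOpen_top _) (hX.isAffineOpen hU) e₁) ?_ ?_ ?_ ?_ ?_
    · have h1 := (j ≫ s).smooth_appLE (isAffineOpen_top _) ((hX.isAffineOpen hU).preimage j)
        (fun _ _ => trivial)
      convert h1
      ext b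
      exact pull_pull j s e₁ le_rfl b
    · have := j.app_surjective _ (hX.isAffineOpen hU)
      rwa [Scheme.Hom.app_eq_appLE] at this
    · exact fun q hq hle => one_lt_height_of_ker_le j hcodim (hX.isAffineOpen hU) q hq hle
    · rw [← hI, ← hIJ, Ideal.map, Set.image_eq_range]
      rfl
    · rintro ⟨x, hx⟩ ⟨x', hx'⟩
      rw [← hI]
      have hx₀ : r x ∈ j.ker.ideal ⟨iX ⁻¹ᵁ U, hX.isAffineOpen hU⟩ := by
        rw [← hIJ]
        exact Ideal.mem_map_of_mem _ hx
      have hpre := preimage_generatorLocus hπ hJ hL hJL hU hx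
      have hgen := isGeneratorOn_generatorLocus π₂ (J.ideal ⟨U, hU⟩) x
      have hV₂ := (hbl₂.chart ⟨U, hU⟩ hx).1
      obtain ⟨-, hV'⟩ := hbl.chart ⟨_, hX.isAffineOpen hU⟩ hx₀
      rw [← hpre] at hV'
      have eG := hFY.le_preimage hY (generatorLocus π₂ (J.ideal ⟨U, hU⟩) x)
      have e₀ : iY ⁻¹ᵁ generatorLocus π₂ (J.ideal ⟨U, hU⟩) x ≤ π ⁻¹ᵁ iX ⁻¹ᵁ U := by
        rw [← preimage_comm hπ]
        exact fun s hs => hgen.le hs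
      refine (hY.isDeformation _ hV₂).exists_mem_pow_of_isBlowupAlgebra
        (pull_comm hπ le_rfl hgen.le e₀ le_rfl) (F := pull FX eF) (G := pull FY eG) ?_
        (fun d => hFY.pull_pull eG le_rfl d) hx hx' (hgen.isGenerator hgen.le) hIJ.le (hV' e₀)
        (ha x) (ha x')
      ext b
      rw [RingHom.comp_apply, RingHom.comp_apply, pull_pull, pull_pull]
      exact pull_congr hF.symm _ _ _
  have h1 := key ⟨x, hx⟩
  rw [← hI, ← hIJ] at h1
  obtain ⟨b, hb, hb'⟩ := IsDeformation.exists_mem_pow hA.surjective h1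
  -- The term `p a` depends only on `a` modulo `p`, so `a` may be replaced by `b ∈ J^p`.
  rw [ha x, hA.mul_congr hb'.symm]
  exact add_mem (Ideal.pow_mem_pow hx p) (Ideal.mul_mem_left _ _ hb)

end FrobLift

theorem mainTheorem5
    {k : Type u} [Field k] (p : ℕ) [Fact p.Prime] [CharP k p] [PerfectRing k p]
    -- the smooth scheme `X`, the smooth center `Z` of codimension `> 1`, the blow-up `π : Y ⟶ X`
    -- of `X` along `Z`, and the exceptional divisor `E = π⁻¹(Z)`
    {X Z Y E : Scheme.{u}}
    (s : X ⟶ Spec (CommRingCat.of k)) (j : Z ⟶ X) (π : Y ⟶ X) (e : E ⟶ Y) (q : E ⟶ Z)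
    (hX : Smooth s) (hj : IsClosedImmersion j) (hZ : Smooth (j ≫ s))
    (hcodim : ∀ z : Z, 1 < ringKrullDim (X.presheaf.stalk (j z)))
    (hY : FrobLift.IsBlowup π j.ker) (hE : IsPullback e q π j)
    -- a lifting `Y₂` of `Y`, with the induced liftings `X₂` of `X`, `Z₂ ⊆ X₂` of `Z ⊆ X` and
    -- `E₂ ⊆ Y₂` of `E ⊆ Y`, which form a commutative square lifting that of `E, Y, Z, X`
    {X₂ Z₂ Y₂ E₂ : Scheme.{u}}
    (s₂ : X₂ ⟶ Spec (CommRingCat.of (FrobLift.W₂ p k)))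
    (j₂ : Z₂ ⟶ X₂) (π₂ : Y₂ ⟶ X₂) (e₂ : E₂ ⟶ Y₂) (q₂ : E₂ ⟶ Z₂)
    (hj₂ : IsClosedImmersion j₂) (he₂ : IsClosedImmersion e₂) (hsq : e₂ ≫ π₂ = q₂ ≫ j₂)
    (iX : X ⟶ X₂) (iZ : Z ⟶ Z₂) (iY : Y ⟶ Y₂) (iE : E ⟶ E₂)
    (hX₂ : FrobLift.IsLifting p s s₂ iX)
    (hZ₂ : FrobLift.IsLifting p (j ≫ s) (j₂ ≫ s₂) iZ)
    (hY₂ : FrobLift.IsLifting p (π ≫ s) (π₂ ≫ s₂) iY)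
    (hE₂ : FrobLift.IsLifting p (e ≫ π ≫ s) (e₂ ≫ π₂ ≫ s₂) iE)
    (hjlift : iZ ≫ j₂ = j ≫ iX) (hπlift : iY ≫ π₂ = π ≫ iX) (helift : iE ≫ e₂ = e ≫ iY) :
    FrobLift.IsBlowup π₂ j₂.ker ∧
    ∀ FX : X₂ ⟶ X₂, FrobLift.LiftsFrobenius p s iX FX →
      ((∃ FY : Y₂ ⟶ Y₂, FrobLift.LiftsFrobenius p (π ≫ s) iY FY ∧ FY ≫ π₂ = π₂ ≫ FX) ↔
        FrobLift.IsFrobeniusCompatible p FX j₂.ker) ∧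
      ∀ FY : Y₂ ⟶ Y₂, FrobLift.LiftsFrobenius p (π ≫ s) iY FY → FY ≫ π₂ = π₂ ≫ FX →
        FrobLift.IsFrobeniusCompatible p FY e₂.ker := by
  have hX' := hX₂.isThickening
  have hZ' := hZ₂.isThickening
  have hY' := hY₂.isThickening
  have hE' := hE₂.isThickening
  have he : IsClosedImmersion e :=
    MorphismProperty.of_isPullback (P := @IsClosedImmersion) hE.flip hj
  have hker : e.ker = j.ker.comap π := by
    rw [← Scheme.IdealSheafData.ker_fst_of_isClosedImmersion, ← hE.isoPullback_hom_fst,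
      Scheme.Hom.ker_comp_of_isIso]
  have hJ := FrobLift.liftsIdeal_ker hX' hZ' hjlift
  have hL := FrobLift.liftsIdeal_ker hY' hE' helift
  rw [hker] at hL
  -- The commutative square of liftings enters here: `E₂` maps into `Z₂`.
  have hJL : j₂.ker.comap π₂ ≤ e₂.ker := by
    rw [← Scheme.IdealSheafData.le_map_iff_comap_le, Scheme.IdealSheafData.map_ker, hsq]
    exact Scheme.Hom.le_ker_comp q₂ j₂
  have hbl := FrobLift.isBlowup_of_lift hπlift hJ hL hJL hY
  have hforward : ∀ FX : X₂ ⟶ X₂, FrobLift.LiftsFrobenius p s iX FX → ∀ FY : Y₂ ⟶ Y₂,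
      FrobLift.LiftsFrobenius p (π ≫ s) iY FY → FY ≫ π₂ = π₂ ≫ FX →
      FrobLift.IsFrobeniusCompatible p FX j₂.ker := fun FX hFX FY hFY hF =>
    FrobLift.isFrobeniusCompatible_of_liftsFrobenius hcodim hπlift hJ hL hJL hY hbl hFX hFY hF
  refine ⟨hbl, fun FX hFX => ⟨⟨fun ⟨FY, hFY, hF⟩ => hforward FX hFX FY hFY hF,
    fun hc => hbl.exists_liftsFrobenius hX' hY' hFX hπlift hc⟩, fun FY hFY hF => ?_⟩⟩
  rw [FrobLift.eq_comap_of_liftsIdeal hπlift hJ hL hJL hY.isInvertibleIdeal]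
  exact (hforward FX hFX FY hFY hF).comap hF
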